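/- Let $X$ be an integral scheme which is smooth and proper over $\mathbb{C}$ (for instance a connected smooth projective variety), let $V$ be a finite dimensional complex vector space, and let $G\subset \mathrm{SL}(V)$ be a reductive algebraic subgroup. Let $\kappa\colon \mathrm{GL}(V)\to \mathrm{GL}(W)$ be a finite dimensional rational representation and $w_0\in W\setminus\{0\}$ a point such that the $\mathrm{SL}(V)$-stabilizer of $w_0$ is $G$, the orbit $\mathrm{SL}(V)\cdot w_0\cong \mathrm{SL}(V)/G$ is Zariski closed in $W$, and $\mathbb{C}^*=\mathbb{C}^*\cdot \mathrm{id}_V$ acts on $W$ with positive weights only. Let $\widetilde{G}\subset \mathrm{GL}(V)$ be the $\mathrm{GL}(V)$-stabilizer of $w_0$. A singular principal $\widetilde{G}$-bundle on $X$ is a pair $(\mathcal{A},\widetilde{\tau})$ which consists of a coherent torsion free sheaf $\mathcal{A}$ on $X$ of rank $\dim V$ with $\det(\mathcal{A})=(\bigwedge^{\dim V}\mathcal{A})^{\vee\vee}\cong\mathcal{O}_X$ and a homomorphism $\widetilde{\tau}\colon \mathrm{Sym}^*(V\otimes\mathcal{A})^{\widetilde{G}}\to\mathcal{O}_X$ of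 $\mathcal{O}_X$-algebras for which the induced section $X\to \underline{\mathrm{Spec}}(\mathrm{Sym}^*(V\otimes\mathcal{A})^{\widetilde{G}})$ is not the zero section. Let $(\mathcal{A},\widetilde{\tau})$ be a singular principal $\widetilde{G}$-bundle on $X$, let $U$ be the maximal open subset of $X$ on which $\mathcal{A}$ is locally free, and let $$\widetilde{\sigma}\colon U\to \underline{\mathrm{Hom}}(V\otimes\mathcal{O}_U,\mathcal{A}^\vee_{|U})/\!/\widetilde{G}=\underline{\mathrm{Spec}}\bigl(\mathrm{Sym}^*(V\otimes\mathcal{A}_{|U})^{\widetilde{G}}\bigr)$$ be the section defined by $\widetilde{\tau}_{|U}$. Let $\underline{\mathrm{Isom}}(V\otimes\mathcal{O}_U,\mathcal{A}^\vee_{|U})/\widetilde{G}$ be the image of $\underline{\mathrm{Isom}}(V\otimes\mathcal{O}_U,\mathcal{A}^\vee_{|U})$ under the quotient map. Then either $\widetilde{\sigma}(x)\in \underline{\mathrm{Isom}}(V\otimes\mathcal{O}_U,\mathcal{A}^\vee_{|U})/\widetilde{G}$ for all $x\in U$, or $\widetilde{\sigma}(x)\notin \underline{\mathrm{Isom}}(V\otimes\mathcal{O}_U,\mathcal{A}^\vee_{|U})/\widetilde{G}$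 for all $x\in U$. -/

import Mathlib

open AlgebraicGeometry CategoryTheory
open scoped TensorProduct

noncomputable section

namespace SingularBundle

/-! ### Algebraic groups inside `GL(V)` -/

section Groups

variable (V : Type) [AddCommGroup V] [Module ℂ V]

/-- The polynomial functions on a vector space: the algebra generated by the linear forms. -/
def polynomialFunctions : Subalgebra ℂ (V → ℂ) :=
  Algebra.adjoin ℂ {p | ∃ ξ : Module.Dual ℂ V, p = fun v => ξ v}

/-- The regular functions on `GL(V)`: the algebra generated by the matrix coefficients of `g` and
of `g⁻¹`. -/
def regularFunctions : Subalgebra ℂ ((V ≃ₗ[ℂ] V) → ℂ) :=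
  Algebra.adjoin ℂ
    ({p | ∃ (ξ : Module.Dual ℂ V) (v : V), p = fun g => ξ (g v)} ∪
      {p | ∃ (ξ : Module.Dual ℂ V) (v : V), p = fun g => ξ (g⁻¹ v)})

variable {V}

/-- Zariski closed subsets of a vector space. -/
def IsZariskiClosed (S : Set V) : Prop :=
  ∃ P : Set (V → ℂ), P ⊆ polynomialFunctions V ∧ S = {v | ∀ p ∈ P, p v = 0}

/-- A subgroup of `GL(V)` is algebraic if it is Zariski closed in `GL(V)`. -/
def IsAlgebraicSubgroup (H : Subgroup (V ≃ₗ[ℂ] V)) : Prop :=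
  ∃ P : Set ((V ≃ₗ[ℂ] V) → ℂ), P ⊆ regularFunctions V ∧
    (H : Set (V ≃ₗ[ℂ] V)) = {g | ∀ p ∈ P, p g = 0}

/-- A representation of `GL(V)` is rational if its matrix coefficients are regular functions. -/
def IsRationalRep {W : Type} [AddCommGroup W] [Module ℂ W]
    (κ : Representation ℂ (V ≃ₗ[ℂ] V) W) : Prop :=
  ∀ (ξ : Module.Dual ℂ W) (w : W), (fun g => ξ (κ g w)) ∈ regularFunctions V

/-- A representation of an algebraic subgroup `H` of `GL(V)` is rational if its matrix coefficients
are regular functions on `H`, i.e. restrictions of regular functions on `GL(V)`. -/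
def IsRationalRepOf (H : Subgroup (V ≃ₗ[ℂ] V)) {E : Type} [AddCommGroup E] [Module ℂ E]
    (π : Representation ℂ H E) : Prop :=
  ∀ (ξ : Module.Dual ℂ E) (e : E), ∃ p ∈ regularFunctions V, ∀ h : H, ξ (π h e) = p h

/-- Reductive complex algebraic groups `G ⊆ GL(V)`: every finite dimensional rational
representation of `G` is completely reducible. -/
def IsReductive (G : Subgroup (V ≃ₗ[ℂ] V)) : Prop :=
  IsAlgebraicSubgroup G ∧
    ∀ (E : Type) [AddCommGroup E] [Module ℂ E] [FiniteDimensional ℂ E]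
      (π : Representation ℂ G E), IsRationalRepOf G π →
      ∀ F : Submodule ℂ E, (∀ g, F ≤ F.comap (π g)) →
        ∃ F' : Submodule ℂ E, (∀ g, F' ≤ F'.comap (π g)) ∧ IsCompl F F'

/-- The rational representation `κ : GL(V) → GL(W)` and the point `w₀ = [e] ∈ W` attached to a
subgroup `G ⊆ SL(V)`: acting on `w₀` induces an `SL(V)`-equivariant closed embedding
`SL(V)/G ↪ W` which does not meet the origin, and `ℂ^* = ℂ^* · id_V` acts on `W` with positive
weights only. -/
structure IsOrbitEmbedding (G : Subgroup (V ≃ₗ[ℂ] V)) {W : Type} [AddCommGroup W] [Module ℂ W]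
    (κ : Representation ℂ (V ≃ₗ[ℂ] V) W) (w₀ : W) : Prop where
  rational : IsRationalRep κ
  stabilizer : ∀ g : V ≃ₗ[ℂ] V,
    g ∈ G ↔ LinearMap.det (g : V →ₗ[ℂ] V) = 1 ∧ κ g w₀ = w₀
  closed : IsZariskiClosed
    {w : W | ∃ g : V ≃ₗ[ℂ] V, LinearMap.det (g : V →ₗ[ℂ] V) = 1 ∧ w = κ g w₀}
  ne_zero : w₀ ≠ 0
  weights_pos : Submodule.span ℂ
    {w : W | ∃ n : ℕ, 0 < n ∧ ∀ z : ℂˣ, κ (LinearEquiv.smulOfUnit z) w = (z : ℂ) ^ n • w} = ⊤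

/-- The group `G̃`: the stabilizer of `w₀` in `GL(V)`. -/
def stabilizerGL {W : Type} [AddCommGroup W] [Module ℂ W]
    (κ : Representation ℂ (V ≃ₗ[ℂ] V) W) (w₀ : W) : Subgroup (V ≃ₗ[ℂ] V) where
  carrier := {g | κ g w₀ = w₀}
  mul_mem' {a b} ha hb := by
    simp only [Set.mem_ofPred_eq] at ha hb ⊢
    rw [map_mul, Module.End.mul_apply, hb, ha]
  one_mem' := by simp
  inv_mem' {a} ha := by
    simp only [Set.mem_ofPred_eq] at ha ⊢
    conv_lhs => rw [← ha]
    rw [← Module.End.mul_apply, ← map_mul, inv_mul_cancel, map_one, Module.End.one_apply]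

end Groups

/-! ### The affine local picture

For a `ℂ`-algebra `R` and an `R`-module `M` we write `V ⊗ M` as `(R ⊗[ℂ] V) ⊗[R] M`. If `M` is
locally free of finite rank, `Spec (Sym^*(V ⊗ M))` is the bundle `Hom(V ⊗ O, M^∨)` over `Spec R`,
and `Spec (Sym^*(V ⊗ M)^H)` is its quotient `Hom(V ⊗ O, M^∨) // H`. -/

section Affine

variable (R : Type) [CommRing R] [Algebra ℂ R]
variable (V : Type) [AddCommGroup V] [Module ℂ V]
variable (M : Type) [AddCommGroup M] [Module R M]

/-- The algebra `Sym^*(V ⊗ M)`. -/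
abbrev HomAlg : Type := SymmetricAlgebra R ((R ⊗[ℂ] V) ⊗[R] M)

variable {R V M}

/-- The generator `v ⊗ m` of `Sym^*(V ⊗ M)`. -/
def gen (v : V) (m : M) : HomAlg R V M :=
  SymmetricAlgebra.ι R _ (((1 : R) ⊗ₜ[ℂ] v) ⊗ₜ[R] m)

variable (R M) in
/-- The action of `g ∈ GL(V)` on `Sym^*(V ⊗ M)`, induced by `v ⊗ m ↦ g v ⊗ m`. -/
def glAct (g : V ≃ₗ[ℂ] V) : HomAlg R V M →ₐ[R] HomAlg R V M :=
  SymmetricAlgebra.lift ((SymmetricAlgebra.ι R _).comp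
    (TensorProduct.map ((g : V →ₗ[ℂ] V).baseChange R) LinearMap.id))

lemma glAct_gen (g : V ≃ₗ[ℂ] V) (v : V) (m : M) :
    glAct R M g (gen v m) = gen (g v) m := by
  simp [glAct, gen]

variable (R M) in
/-- The algebra of invariants `Sym^*(V ⊗ M)^H`. -/
def invariants (H : Subgroup (V ≃ₗ[ℂ] V)) : Subalgebra R (HomAlg R V M) where
  carrier := {p | ∀ g ∈ H, glAct R M g p = p}
  mul_mem' ha hb g hg := by rw [map_mul, ha g hg, hb g hg]
  add_mem' ha hb g hg := by rw [map_add, ha g hg, hb g hg]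
  algebraMap_mem' r g _ := by rw [AlgHom.commutes]

/-- The fibre `V ⊗ κ(q) → Hom_R(M, κ(q))`, `v ↦ (m ↦ (v ⊗ m)(q))`, of the universal homomorphism
`V ⊗ O → h^* M^∨` at a point `q` of `h : Spec (Sym^*(V ⊗ M)) → Spec R`. For `M` locally free of
finite rank, `Hom_R(M, κ(q))` is the fibre of `h^* M^∨` at `q`. -/
def universalHom (q : PrimeSpectrum (HomAlg R V M)) :
    q.asIdeal.ResidueField ⊗[R] (R ⊗[ℂ] V) →ₗ[q.asIdeal.ResidueField]
      (M →ₗ[R] q.asIdeal.ResidueField) :=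
  LinearMap.liftBaseChange q.asIdeal.ResidueField
    (TensorProduct.curry
      ((IsScalarTower.toAlgHom R (HomAlg R V M) q.asIdeal.ResidueField).toLinearMap.comp
        (SymmetricAlgebra.ι R ((R ⊗[ℂ] V) ⊗[R] M))))

lemma universalHom_tmul (q : PrimeSpectrum (HomAlg R V M)) (v : V) (m : M) :
    universalHom q (1 ⊗ₜ (1 ⊗ₜ v)) m = algebraMap (HomAlg R V M) _ (gen v m) := by
  simp [universalHom, gen]

variable (R V M) in
/-- The points of `Isom(V ⊗ O, M^∨) ⊆ Hom(V ⊗ O, M^∨)`: those at which the universal homomorphism is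
an isomorphism. -/
def isomLocus : Set (PrimeSpectrum (HomAlg R V M)) :=
  {q | Function.Bijective (universalHom q)}

variable (R M) in
/-- `Isom(V ⊗ O, M^∨)/H`, the image of `Isom(V ⊗ O, M^∨)` under the quotient map
`Hom(V ⊗ O, M^∨) → Hom(V ⊗ O, M^∨) // H`. -/
def isomQuotient (H : Subgroup (V ≃ₗ[ℂ] V)) : Set (PrimeSpectrum (invariants R M H)) :=
  PrimeSpectrum.comap (invariants R M H).val.toRingHom '' isomLocus R V M

variable {R' : Type} [CommRing R'] [Algebra ℂ R']
variable {M' : Type} [AddCommGroup M'] [Module R' M']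

/-- The ring homomorphism `Sym^*(V ⊗ M) → Sym^*(V ⊗ M')` induced by `R → R'` and a semilinear map
`M → M'`. -/
def changeRing (φ : R →ₐ[ℂ] R') (ψ : M →ₛₗ[(φ : R →+* R')] M') :
    HomAlg R V M →+* HomAlg R' V M' :=
  letI : Algebra R (HomAlg R' V M') :=
    ((algebraMap R' (HomAlg R' V M')).comp (φ : R →+* R')).toAlgebra
  (SymmetricAlgebra.lift (R := R) (A := HomAlg R' V M') (TensorProduct.lift
    (LinearMap.mk₂ R
      (fun (x : R ⊗[ℂ] V) (m : M) => SymmetricAlgebra.ι R' ((R' ⊗[ℂ] V) ⊗[R'] M')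
        ((LinearMap.rTensor V φ.toLinearMap x) ⊗ₜ[R'] ψ m))
      (fun x y m => by rw [map_add, TensorProduct.add_tmul, map_add])
      (fun r x m => by
        have h : LinearMap.rTensor V φ.toLinearMap (r • x)
            = φ r • LinearMap.rTensor V φ.toLinearMap x := by
          induction x with
          | zero => simp
          | add x y hx hy => rw [smul_add, map_add, hx, hy, map_add, smul_add]
          | tmul s v => simp [TensorProduct.smul_tmul']
        rw [h, ← TensorProduct.smul_tmul', map_smul, Algebra.smul_def, Algebra.smul_def]
        rfl)
      (fun x m n => by rw [map_add, TensorProduct.tmul_add, map_add])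
      (fun r x m => by
        rw [LinearMap.map_smulₛₗ, TensorProduct.tmul_smul, map_smul, Algebra.smul_def,
          Algebra.smul_def]
        rfl)))).toRingHom

lemma changeRing_algebraMap (φ : R →ₐ[ℂ] R') (ψ : M →ₛₗ[(φ : R →+* R')] M') (r : R) :
    changeRing (V := V) φ ψ (algebraMap R _ r) = algebraMap R' _ (φ r) := by
  let : Algebra R (HomAlg R' V M') :=
    ((algebraMap R' (HomAlg R' V M')).comp (φ : R →+* R')).toAlgebra
  exact AlgHom.commutes (A := HomAlg R V M) (B := HomAlg R' V M') _ r

lemma changeRing_ι (φ : R →ₐ[ℂ] R') (ψ : M →ₛₗ[(φ : R →+* R')] M') (r : R) (v : V) (m : M) :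
    changeRing φ ψ (SymmetricAlgebra.ι R _ ((r ⊗ₜ[ℂ] v) ⊗ₜ[R] m))
      = SymmetricAlgebra.ι R' _ ((φ r ⊗ₜ[ℂ] v) ⊗ₜ[R'] ψ m) := by
  let : Algebra R (HomAlg R' V M') :=
    ((algebraMap R' (HomAlg R' V M')).comp (φ : R →+* R')).toAlgebra
  refine (SymmetricAlgebra.lift_ι_apply (A := HomAlg R' V M') _ _).trans ?_
  simp

lemma changeRing_glAct (φ : R →ₐ[ℂ] R') (ψ : M →ₛₗ[(φ : R →+* R')] M') (g : V ≃ₗ[ℂ] V)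
    (p : HomAlg R V M) :
    changeRing φ ψ (glAct R M g p) = glAct R' M' g (changeRing φ ψ p) := by
  induction p using SymmetricAlgebra.induction with
  | algebraMap r => simp only [AlgHom.commutes, changeRing_algebraMap]
  | mul a b ha hb => simp only [map_mul, ha, hb]
  | add a b ha hb => simp only [map_add, ha, hb]
  | ι x =>
    induction x with
    | zero => simp
    | add x y hx hy => simp only [map_add, hx, hy]
    | tmul x m =>
      induction x with
      | zero => simp
      | add x y hx hy => simp only [TensorProduct.add_tmul, map_add, hx, hy]
      | tmul r v => simp [glAct, changeRing_ι]

/-- The ring homomorphism `Sym^*(V ⊗ M)^H → Sym^*(V ⊗ M')^H` induced by `R → R'` and a semilinear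
map `M → M'`. -/
def changeRingInvariants (H : Subgroup (V ≃ₗ[ℂ] V)) (φ : R →ₐ[ℂ] R')
    (ψ : M →ₛₗ[(φ : R →+* R')] M') : invariants R M H →+* invariants R' M' H :=
  ((changeRing φ ψ).comp (invariants R M H).val.toRingHom).codRestrict (invariants R' M' H)
    (fun p g hg => by
      change glAct R' M' g (changeRing φ ψ p.1) = changeRing φ ψ p.1
      rw [← changeRing_glAct, p.2 g hg])

end Affine

/-! ### Sheaves on a complex scheme -/

section Sheaves

variable {X : Scheme.{0}}

/-- Restriction of functions. -/
def resO {W W' : X.Opens} (h : W' ≤ W) : Γ(X, W) →+* Γ(X, W') :=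
  (X.presheaf.map (homOfLE h).op).hom

lemma resO_resO {W W' W'' : X.Opens} (h : W' ≤ W) (h' : W'' ≤ W') (f : Γ(X, W)) :
    resO h' (resO h f) = resO (h'.trans h) f := by
  simp only [resO, ← CommRingCat.comp_apply, ← Functor.map_comp]
  rfl

/-- Restriction of sections of an `O_X`-module. -/
def resM (A : X.Modules) {W W' : X.Opens} (h : W' ≤ W) : Γ(A, W) →ₛₗ[resO h] Γ(A, W') where
  toFun := A.presheaf.map (homOfLE h).op
  map_add' x y := map_add _ x y
  map_smul' r x := Scheme.Modules.map_smul A (homOfLE h) r x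

/-- `A` is free of finite rank on the open set `W`: there are finitely many sections over `W` whose
restrictions form a basis of `A(W')` over `O_X(W')` for all open subsets `W'` of `W`. -/
def IsFreeOn (A : X.Modules) (W : X.Opens) : Prop :=
  ∃ (n : ℕ) (s : Fin n → Γ(A, W)), ∀ (W' : X.Opens) (h : W' ≤ W),
    LinearIndependent Γ(X, W') (fun i => resM A h (s i)) ∧
      Submodule.span Γ(X, W') (Set.range fun i => resM A h (s i)) = ⊤

/-- The maximal open subset on which `A` is locally free of finite rank. -/
def locallyFreeLocus (A : X.Modules) : X.Opens := sSup {W | IsFreeOn A W}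

/-- The sections over `W` of the sheaf `(⋀^n A)^∨`, i.e. the alternating `O_X`-multilinear forms
`A^n → O_X` over `W`. -/
@[ext]
structure AltForm (A : X.Modules) (n : ℕ) (W : X.Opens) where
  form : ∀ W' : X.Opens, W' ≤ W → Γ(A, W') [⋀^Fin n]→ₗ[Γ(X, W')] Γ(X, W')
  res : ∀ (W' W'' : X.Opens) (h' : W' ≤ W) (h : W'' ≤ W') (v : Fin n → Γ(A, W')),
    form W'' (h.trans h') (fun i => resM A h (v i)) = resO h (form W' h' v)

namespace AltForm

variable {A : X.Modules} {n : ℕ} {W : X.Opens}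

/-- Addition of alternating forms. -/
def add (ω η : AltForm A n W) : AltForm A n W where
  form W' h := ω.form W' h + η.form W' h
  res W' W'' h' h v := by
    rw [AlternatingMap.add_apply, AlternatingMap.add_apply, map_add, ω.res, η.res]

/-- Multiplication of an alternating form by a function. -/
def smul (f : Γ(X, W)) (ω : AltForm A n W) : AltForm A n W where
  form W' h := resO h f • ω.form W' h
  res W' W'' h' h v := by
    rw [AlternatingMap.smul_apply, AlternatingMap.smul_apply, smul_eq_mul, smul_eq_mul, map_mul,
      ω.res, resO_resO]

/-- Restriction of an alternating form. -/
def restrict (ω : AltForm A n W) {W₁ : X.Opens} (h₁ : W₁ ≤ W) : AltForm A n W₁ where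
  form W' h := ω.form W' (h.trans h₁)
  res W' W'' h' h v := ω.res W' W'' (h'.trans h₁) h v

end AltForm

/-- The sections over `W` of the sheaf `(⋀^n A)^∨∨`, i.e. the `O_X`-linear maps
`(⋀^n A)^∨ → O_X` over `W`. If `A` is torsion free of rank `n`, this sheaf is `det A`. -/
structure DetSection (A : X.Modules) (n : ℕ) (W : X.Opens) where
  eval : ∀ W' : X.Opens, W' ≤ W → AltForm A n W' → Γ(X, W')
  add : ∀ (W' : X.Opens) (h : W' ≤ W) (ω η : AltForm A n W'),
    eval W' h (ω.add η) = eval W' h ω + eval W' h η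
  smul : ∀ (W' : X.Opens) (h : W' ≤ W) (f : Γ(X, W')) (ω : AltForm A n W'),
    eval W' h (ω.smul f) = f * eval W' h ω
  res : ∀ (W' W'' : X.Opens) (h' : W' ≤ W) (h : W'' ≤ W') (ω : AltForm A n W'),
    eval W'' (h.trans h') (ω.restrict h) = resO h (eval W' h' ω)

/-- `det A ≅ O_X` for `det A = (⋀^n A)^∨∨`: there is a global section `s` of `det A` such that
`O_X → det A`, `f ↦ f s`, is bijective on the sections over every open set. -/
def HasTrivialDet (A : X.Modules) (n : ℕ) : Prop :=
  ∃ s : DetSection A n ⊤, ∀ (W : X.Opens) (t : DetSection A n W), ∃! f : Γ(X, W),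
    ∀ (W' : X.Opens) (h : W' ≤ W) (ω : AltForm A n W'),
      t.eval W' h ω = resO h f * s.eval W' le_top ω

/-- Coherent torsion free sheaves of rank `n` on an integral noetherian scheme. -/
structure IsTorsionFreeOfRank (A : X.Modules) (n : ℕ) : Prop where
  quasicoherent : A.IsQuasicoherent
  finite : ∀ W : X.Opens, IsAffineOpen W → Module.Finite Γ(X, W) Γ(A, W)
  torsionFree : ∀ W : X.Opens, IsAffineOpen W → Module.IsTorsionFree Γ(X, W) Γ(A, W)
  rank : ∀ W : X.Opens, IsAffineOpen W → (W : Set X).Nonempty →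
    Module.rank Γ(X, W) Γ(A, W) = n

variable [X.Over (Spec (CommRingCat.of ℂ))]

variable (X) in
/-- The structure map `ℂ → O_X(W)` of a complex scheme. -/
def structureMap (W : X.Opens) : ℂ →+* Γ(X, W) :=
  (resO le_top).comp (((X ↘ Spec (CommRingCat.of ℂ)).appTop.hom).comp
    (Scheme.ΓSpecIso (CommRingCat.of ℂ)).inv.hom)

instance algebraSections (W : X.Opens) : Algebra ℂ Γ(X, W) := (structureMap X W).toAlgebra

/-- Restriction of functions on a complex scheme, as a homomorphism of `ℂ`-algebras. -/
def resAlg {W W' : X.Opens} (h : W' ≤ W) : Γ(X, W) →ₐ[ℂ] Γ(X, W') where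
  __ := resO h
  commutes' _ := resO_resO le_top h _

variable {V : Type} [AddCommGroup V] [Module ℂ V]

/-- The restriction maps of the sheaf of algebras `Sym^*(V ⊗ A)^H`. -/
def resInvariants (H : Subgroup (V ≃ₗ[ℂ] V)) (A : X.Modules) {W W' : X.Opens} (h : W' ≤ W) :
    invariants Γ(X, W) Γ(A, W) H →+* invariants Γ(X, W') Γ(A, W') H :=
  changeRingInvariants H (resAlg h) (resM A h)

variable (X) in
/-- Singular principal `H`-bundles `(A, τ)` on `X`, for a subgroup `H` of `GL(V)`: a coherent torsion
free sheaf `A` of rank `dim V` with trivial determinant and a homomorphism of `O_X`-algebras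
`τ : Sym^*(V ⊗ A)^H → O_X` for which the section of `Spec (Sym^*(V ⊗ A)^H)` induced by `τ` is not the
zero section. As `A` is quasi-coherent, the sections of `Sym^*(V ⊗ A)^H` over an affine open set
`W` are the invariants in `Sym^*(V ⊗ A(W))`, and `τ` is given by its values on affine open sets. -/
structure SingularPrincipalBundle (H : Subgroup (V ≃ₗ[ℂ] V)) where
  A : X.Modules
  torsionFree : IsTorsionFreeOfRank A (Module.finrank ℂ V)
  trivialDet : HasTrivialDet A (Module.finrank ℂ V)
  τ : ∀ W : X.Opens, IsAffineOpen W → (invariants Γ(X, W) Γ(A, W) H →ₐ[Γ(X, W)] Γ(X, W))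
  τ_res : ∀ (W W' : X.Opens) (hW : IsAffineOpen W) (hW' : IsAffineOpen W') (h : W' ≤ W)
    (p : invariants Γ(X, W) Γ(A, W) H),
    τ W' hW' (resInvariants H A h p) = resO h (τ W hW p)
  nontrivial : ∃ (W : X.Opens) (hW : IsAffineOpen W) (p : invariants Γ(X, W) Γ(A, W) H),
    τ W hW p ≠ SymmetricAlgebra.algebraMapInv (p : HomAlg Γ(X, W) V Γ(A, W))

namespace SingularPrincipalBundle

variable {H : Subgroup (V ≃ₗ[ℂ] V)} (B : SingularPrincipalBundle X H)

/-- The maximal open subset `U` of `X` on which `A` is locally free. -/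
def U : X.Opens := locallyFreeLocus B.A

/-- The value at `x ∈ W`, for `W` affine open, of the section `σ : W → Spec (Sym^*(V ⊗ A(W))^H)`
defined by `τ`. For `W ⊆ U` the target is the part of `Hom(V ⊗ O_U, A^∨) // H` over `W`. -/
def σ {W : X.Opens} (hW : IsAffineOpen W) (x : W) :
    PrimeSpectrum (invariants Γ(X, W) Γ(B.A, W) H) :=
  PrimeSpectrum.comap (B.τ W hW).toRingHom (hW.primeIdealOf x)

/-- `σ` is entirely contained in `Isom(V ⊗ O_U, A^∨)/H`; one says that `(A, τ)` is honest. -/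
def IsHonest : Prop :=
  ∀ (W : X.Opens) (hW : IsAffineOpen W), W ≤ B.U → ∀ x : W,
    B.σ hW x ∈ isomQuotient Γ(X, W) Γ(B.A, W) H

/-- `σ` is entirely contained in the complement of `Isom(V ⊗ O_U, A^∨)/H`. -/
def AvoidsIsom : Prop :=
  ∀ (W : X.Opens) (hW : IsAffineOpen W), W ≤ B.U → ∀ x : W,
    B.σ hW x ∈ (isomQuotient Γ(X, W) Γ(B.A, W) H)ᶜ

end SingularPrincipalBundle

end Sheaves

end SingularBundle

end

/-! The determinant has finite order N on G̃. Indeed, the closed orbit SL(V)·w₀ misses the origin,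
and all weights of the homotheties are positive, so only finitely many homotheties keep w₀ in this
orbit; an element g of G̃ provides such a homothety, given by a root of det g of order dim V
(`IsOrbitEmbedding.exists_det_pow_eq_one`). Hence products of N determinants det(bᵢ ⊗ mⱼ) are
G̃-invariant, and τ can be evaluated on them.

Let s generate det A, and write m₀ ∧ ⋯ ∧ mₙ₋₁ = coord(m)·s, with n = dim V. Since A has rank n,
alternating n-forms are proportional, so τ(det(m)^N) = F·coord(m)^N with one rational function F.
Triviality of the reflexive sheaf det A makes F a global regular function f, although A itself need
not be locally free everywhere (`exists_tauDet_eq`). As X is integral and proper, its global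
functions form a field, so f is either zero or a unit.

If f = 0, all these products of determinants vanish along σ, whereas at a point of Isom some
determinant is nonzero. If f is a unit and x lies in U, choose m with coord(m) nonzero at x and lift
σ(x) to a point q of Hom; this is possible since the quotient map is surjective
(`IsOrbitEmbedding.comap_surjective`, using reductivity of G and finiteness of G̃/G). Then det(m) is
nonzero at q, and Cramer's rule shows that m generates A near x, so q lies in Isom. -/

noncomputable section

namespace SingularBundle

/-! ### Reductive groups: regular maps and lifting of invariants. -/

section Reductive

variable {V : Type} [AddCommGroup V] [Module ℂ V]

variable (V) in
/-- The regular functions on `GL(V)` with values in a vector space `E`. -/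
def regularMaps (E : Type) [AddCommGroup E] [Module ℂ E] : Submodule ℂ ((V ≃ₗ[ℂ] V) → E) :=
  Submodule.span ℂ {f | ∃ p ∈ regularFunctions V, ∃ e : E, f = fun g => p g • e}

/-- A possibly infinite dimensional representation of `GL(V)` is locally rational if all of its
orbit maps are regular. -/
def IsLocallyRational {E : Type} [AddCommGroup E] [Module ℂ E]
    (ρ : Representation ℂ (V ≃ₗ[ℂ] V) E) : Prop :=
  ∀ e, (fun g => ρ g e) ∈ regularMaps V E

section RegularMaps

variable {E E' : Type} [AddCommGroup E] [Module ℂ E] [AddCommGroup E'] [Module ℂ E']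

lemma smul_mem_regularMaps {p : (V ≃ₗ[ℂ] V) → ℂ} (hp : p ∈ regularFunctions V) (e : E) :
    (fun g => p g • e) ∈ regularMaps V E :=
  Submodule.subset_span ⟨p, hp, e, rfl⟩

lemma const_mem_regularMaps (e : E) : (fun _ => e) ∈ regularMaps V E := by
  have := smul_mem_regularMaps (V := V) (one_mem (regularFunctions V)) e
  simpa using this

lemma comp_mem_regularMaps (L : E →ₗ[ℂ] E') {f : (V ≃ₗ[ℂ] V) → E} (hf : f ∈ regularMaps V E) :
    (fun g => L (f g)) ∈ regularMaps V E' := by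
  induction hf using Submodule.span_induction with
  | mem f hf =>
    obtain ⟨p, hp, e, rfl⟩ := hf
    simpa using smul_mem_regularMaps hp (L e)
  | zero =>
    convert zero_mem (regularMaps V E') using 1
    ext g
    simp
  | add f f' _ _ hf hf' =>
    convert add_mem hf hf' using 1
    ext g
    simp
  | smul a f _ hf =>
    convert Submodule.smul_mem _ a hf using 1
    ext g
    simp

lemma dual_comp_mem_regularFunctions (ξ : Module.Dual ℂ E) {f : (V ≃ₗ[ℂ] V) → E}
    (hf : f ∈ regularMaps V E) : (fun g => ξ (f g)) ∈ regularFunctions V := by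
  induction hf using Submodule.span_induction with
  | mem f hf =>
    obtain ⟨p, hp, e, rfl⟩ := hf
    have := Subalgebra.smul_mem _ hp (ξ e)
    convert this using 1
    ext g
    simp [mul_comm]
  | zero =>
    convert zero_mem (regularFunctions V) using 1
    ext g
    simp
  | add f f' _ _ hf hf' =>
    convert add_mem hf hf' using 1
    ext g
    simp
  | smul a f _ hf =>
    convert Subalgebra.smul_mem _ hf a using 1
    ext g
    simp

/-- A regular map is a finite sum of terms p·e. This is the local finiteness that brings infinite
dimensional representations within reach of reductivity. -/
lemma exists_finiteDimensional_of_mem_regularMaps {f : (V ≃ₗ[ℂ] V) → E}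
    (hf : f ∈ regularMaps V E) :
    ∃ F : Submodule ℂ E, FiniteDimensional ℂ F ∧ ∀ g, f g ∈ F := by
  induction hf using Submodule.span_induction with
  | mem f hf =>
    obtain ⟨p, hp, e, rfl⟩ := hf
    exact ⟨Submodule.span ℂ {e}, inferInstance,
      fun g => Submodule.smul_mem _ _ (Submodule.mem_span_singleton_self e)⟩
  | zero => exact ⟨⊥, inferInstance, fun g => zero_mem _⟩
  | add f f' _ _ hf hf' =>
    obtain ⟨F, _, hF⟩ := hf
    obtain ⟨F', _, hF'⟩ := hf'
    exact ⟨F ⊔ F', inferInstance,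
      fun g => add_mem (Submodule.mem_sup_left (hF g)) (Submodule.mem_sup_right (hF' g))⟩
  | smul a f _ hf =>
    obtain ⟨F, _, hF⟩ := hf
    exact ⟨F, ‹_›, fun g => Submodule.smul_mem _ _ (hF g)⟩

lemma mul_mem_regularMaps {S : Type} [CommRing S] [Algebra ℂ S] {f f' : (V ≃ₗ[ℂ] V) → S}
    (hf : f ∈ regularMaps V S) (hf' : f' ∈ regularMaps V S) :
    (fun g => f g * f' g) ∈ regularMaps V S := by
  induction hf using Submodule.span_induction with
  | mem f hf =>
    obtain ⟨p, hp, e, rfl⟩ := hf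
    induction hf' using Submodule.span_induction with
    | mem f' hf' =>
      obtain ⟨p', hp', e', rfl⟩ := hf'
      have := smul_mem_regularMaps (mul_mem hp hp') (e * e')
      convert this using 1
      ext g
      simp [smul_smul, mul_comm]
    | zero =>
      convert zero_mem (regularMaps V S) using 1
      ext g
      simp
    | add f f' _ _ hf hf' =>
      convert add_mem hf hf' using 1
      ext g
      simp [mul_add]
    | smul a f _ hf =>
      have := Submodule.smul_mem _ a hf
      convert this using 1
      ext g
      simp
  | zero =>
    convert zero_mem (regularMaps V S) using 1
    ext g
    simp
  | add f f' _ _ hf hf' =>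
    convert add_mem hf hf' using 1
    ext g
    simp [add_mul]
  | smul a f _ hf =>
    convert Submodule.smul_mem _ a hf using 1
    ext g
    simp

end RegularMaps

/-- A vector whose image under a linear map `L` is not changed by the action of a reductive group
can be replaced by an invariant vector with the same image. -/
lemma IsReductive.exists_invariant {G : Subgroup (V ≃ₗ[ℂ] V)} (hG : IsReductive G)
    {E E' : Type} [AddCommGroup E] [Module ℂ E] [AddCommGroup E'] [Module ℂ E']
    {ρ : Representation ℂ (V ≃ₗ[ℂ] V) E} (hρ : IsLocallyRational ρ) (L : E →ₗ[ℂ] E') (e₀ : E)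
    (h : ∀ g ∈ G, L (ρ g e₀) = L e₀) :
    ∃ e, (∀ g ∈ G, ρ g e = e) ∧ L e = L e₀ := by
  -- The span of the G-orbit of e₀ is finite dimensional and G-stable, and L is G-invariant on it.
  -- Thus ker L ∩ F has a stable complement F', and the F'-component of e₀ is the desired vector.
  set F : Submodule ℂ E := Submodule.span ℂ (Set.range fun g : G => ρ g e₀) with hFdef
  have hF : ∀ g ∈ G, ∀ x ∈ F, ρ g x ∈ F := by
    intro g hg x hx
    induction hx using Submodule.span_induction with
    | mem x hx =>
      obtain ⟨g', rfl⟩ := hx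
      refine Submodule.subset_span ⟨⟨g, hg⟩ * g', ?_⟩
      simp
    | zero => simp
    | add x y _ _ hx hy => rw [map_add]; exact add_mem hx hy
    | smul a x _ hx => rw [map_smul]; exact Submodule.smul_mem _ _ hx
  have hL : ∀ g ∈ G, ∀ x ∈ F, L (ρ g x) = L x := by
    intro g hg x hx
    induction hx using Submodule.span_induction with
    | mem x hx =>
      obtain ⟨g', rfl⟩ := hx
      have := h (g * g') (mul_mem hg g'.2)
      rw [map_mul, Module.End.mul_apply] at this
      rw [this, h g' g'.2]
    | zero => simp
    | add x y _ _ hx hy => simp only [map_add, hx, hy]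
    | smul a x _ hx => simp only [map_smul, hx]
  have he₀ : e₀ ∈ F := Submodule.subset_span ⟨1, by simp⟩
  have : FiniteDimensional ℂ F := by
    obtain ⟨F', _, hF'⟩ := exists_finiteDimensional_of_mem_regularMaps (hρ e₀)
    refine Submodule.finiteDimensional_of_le (S₂ := F') (Submodule.span_le.2 ?_)
    rintro _ ⟨g, rfl⟩
    exact hF' g
  let π : Representation ℂ G F :=
    { toFun g := (ρ g).restrict (hF g g.2)
      map_one' := by ext x; simp
      map_mul' g g' := by ext x; simp }
  have hπ : ∀ (g : G) (x : F), ((π g x : F) : E) = ρ g x := fun g x => rfl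
  have hrat : IsRationalRepOf G π := by
    intro ξ e
    obtain ⟨η, hη⟩ := LinearMap.exists_extend ξ
    refine ⟨_, dual_comp_mem_regularFunctions η (hρ e), fun g => ?_⟩
    rw [← hη]
    rfl
  obtain ⟨F', hF'stab, hcompl⟩ := hG.2 F π hrat (LinearMap.ker (L ∘ₗ F.subtype)) (by
    intro g x hx
    simp only [LinearMap.mem_ker, LinearMap.comp_apply, Submodule.subtype_apply,
      Submodule.mem_comap] at hx ⊢
    rw [hπ, hL g g.2 x x.2, hx])
  obtain ⟨k, hk, f, hf, hkf⟩ := Submodule.mem_sup.1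
    (show (⟨e₀, he₀⟩ : F) ∈ LinearMap.ker (L ∘ₗ F.subtype) ⊔ F' by
      rw [hcompl.sup_eq_top]; trivial)
  refine ⟨f, fun g hg => ?_, ?_⟩
  -- The difference lies in F' by stability and in the kernel by invariance of L, so it vanishes.
  · have h0 : π ⟨g, hg⟩ f - f ∈ LinearMap.ker (L ∘ₗ F.subtype) ⊓ F' := by
      refine ⟨?_, sub_mem (hF'stab ⟨g, hg⟩ hf) hf⟩
      simp [hπ, hL g hg f f.2]
    rw [hcompl.inf_eq_bot, Submodule.mem_bot, sub_eq_zero] at h0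
    have := congrArg Subtype.val h0
    rwa [hπ] at this
  · have := congrArg (fun x : F => L x) hkf
    simp only [Submodule.coe_add, map_add] at this
    rw [← this, show L k = 0 from hk, zero_add]

end Reductive

/-! ### Finiteness of the determinant on G̃. -/

section Stabilizer

variable {V : Type} [AddCommGroup V] [Module ℂ V]
variable {W : Type} [AddCommGroup W] [Module ℂ W]

lemma smulOfUnit_mul_comm (z : ℂˣ) (g : V ≃ₗ[ℂ] V) :
    LinearEquiv.smulOfUnit z * g = g * LinearEquiv.smulOfUnit z := by
  ext v
  exact (map_smul g (z : ℂ) v).symm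

lemma smulOfUnit_mul (z z' : ℂˣ) :
    (LinearEquiv.smulOfUnit (z * z') : V ≃ₗ[ℂ] V)
      = LinearEquiv.smulOfUnit z * LinearEquiv.smulOfUnit z' := by
  ext v
  simp [LinearEquiv.smulOfUnit, mul_smul]

lemma smulOfUnit_one : (LinearEquiv.smulOfUnit (1 : ℂˣ) : V ≃ₗ[ℂ] V) = 1 := by
  ext v
  simp [LinearEquiv.smulOfUnit]

/-- The homotheties which map `w₀` into its `SL(V)`-orbit. -/
def orbitScalars (κ : Representation ℂ (V ≃ₗ[ℂ] V) W) (w₀ : W) : Subgroup ℂˣ where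
  carrier := {z | ∃ g : V ≃ₗ[ℂ] V, LinearEquiv.det g = 1 ∧
    κ (LinearEquiv.smulOfUnit z) w₀ = κ g w₀}
  one_mem' := ⟨1, map_one _, by rw [smulOfUnit_one]⟩
  mul_mem' {z z'} := by
    rintro ⟨g, hg, h⟩ ⟨g', hg', h'⟩
    refine ⟨g' * g, by rw [map_mul, hg, hg', one_mul], ?_⟩
    rw [smulOfUnit_mul, map_mul, Module.End.mul_apply, h', ← Module.End.mul_apply, ← map_mul,
      smulOfUnit_mul_comm, map_mul, Module.End.mul_apply, h, map_mul, Module.End.mul_apply]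
  inv_mem' {z} := by
    rintro ⟨g, hg, h⟩
    refine ⟨g⁻¹, by rw [map_inv, hg, inv_one], ?_⟩
    have h1 : κ (LinearEquiv.smulOfUnit z⁻¹ * g) w₀ = w₀ := by
      rw [map_mul, Module.End.mul_apply, ← h, ← Module.End.mul_apply, ← map_mul,
        ← smulOfUnit_mul, inv_mul_cancel, smulOfUnit_one, map_one, Module.End.one_apply]
    rw [smulOfUnit_mul_comm, map_mul, Module.End.mul_apply] at h1
    conv_rhs => rw [← h1]
    rw [← Module.End.mul_apply, ← map_mul, inv_mul_cancel, map_one, Module.End.one_apply]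

variable {G : Subgroup (V ≃ₗ[ℂ] V)} {κ : Representation ℂ (V ≃ₗ[ℂ] V) W} {w₀ : W}

/-- Along the homotheties, a polynomial function on `W` is polynomial. -/
lemma IsOrbitEmbedding.exists_polynomial (hκ : IsOrbitEmbedding G κ w₀) {p : W → ℂ}
    (hp : p ∈ polynomialFunctions W) :
    ∃ Q : Polynomial ℂ, Q.eval 0 = p 0 ∧
      ∀ z : ℂˣ, Q.eval (z : ℂ) = p (κ (LinearEquiv.smulOfUnit z) w₀) := by
  induction hp using Algebra.adjoin_induction with
  | mem p hp =>
    obtain ⟨ξ, rfl⟩ := hp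
    have hw : w₀ ∈ Submodule.span ℂ {w : W | ∃ n : ℕ, 0 < n ∧
        ∀ z : ℂˣ, κ (LinearEquiv.smulOfUnit z) w = (z : ℂ) ^ n • w} := by
      rw [hκ.weights_pos]; trivial
    clear hκ
    induction hw using Submodule.span_induction with
    | mem w hw =>
      obtain ⟨n, hn, hw⟩ := hw
      -- Positivity of the weight n is what gives the value ξ 0 = 0 at z = 0.
      refine ⟨Polynomial.C (ξ w) * Polynomial.X ^ n, by simp [hn.ne'], fun z => ?_⟩
      beta_reduce
      rw [hw, map_smul, Polynomial.eval_mul, Polynomial.eval_C, Polynomial.eval_pow,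
        Polynomial.eval_X, smul_eq_mul, mul_comm]
    | zero => exact ⟨0, by simp, by simp⟩
    | add x y _ _ hx hy =>
      obtain ⟨Q, hQ0, hQ⟩ := hx
      obtain ⟨Q', hQ0', hQ'⟩ := hy
      exact ⟨Q + Q', by simp_all, fun z => by simp_all⟩
    | smul a x _ hx =>
      obtain ⟨Q, hQ0, hQ⟩ := hx
      exact ⟨Polynomial.C a * Q, by simp_all, fun z => by simp_all⟩
  | algebraMap r => exact ⟨Polynomial.C r, by simp, by simp⟩
  | add x y _ _ hx hy =>
    obtain ⟨Q, hQ0, hQ⟩ := hx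
    obtain ⟨Q', hQ0', hQ'⟩ := hy
    exact ⟨Q + Q', by simp_all, fun z => by simp_all⟩
  | mul x y _ _ hx hy =>
    obtain ⟨Q, hQ0, hQ⟩ := hx
    obtain ⟨Q', hQ0', hQ'⟩ := hy
    exact ⟨Q * Q', by simp_all, fun z => by simp_all⟩

/-- Since the orbit is closed and misses 0, some polynomial p vanishes on it with p(0) ≠ 0. Then z ↦
p(z·w₀) extends to a polynomial with nonzero constant term, which has the scalars in question among
its roots. -/
lemma IsOrbitEmbedding.finite_orbitScalars (hκ : IsOrbitEmbedding G κ w₀) :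
    Finite (orbitScalars κ w₀) := by
  obtain ⟨P, hP, horb⟩ := hκ.closed
  have h0 : (0 : W) ∉ {w : W | ∀ p ∈ P, p w = 0} := by
    rw [← horb]
    rintro ⟨g, -, hg⟩
    apply hκ.ne_zero
    have := congrArg (κ g⁻¹) hg
    rw [map_zero, ← Module.End.mul_apply, ← map_mul, inv_mul_cancel, map_one,
      Module.End.one_apply] at this
    exact this.symm
  simp only [Set.mem_ofPred_eq, not_forall] at h0
  obtain ⟨p, hpP, hp0⟩ := h0
  obtain ⟨Q, hQ0, hQ⟩ := hκ.exists_polynomial (hP hpP)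
  have hQne : Q ≠ 0 := by
    rintro rfl
    exact hp0 (by simpa using hQ0.symm)
  have hroot : ∀ z : orbitScalars κ w₀, ((z : ℂˣ) : ℂ) ∈ Q.rootSet ℂ := by
    rintro ⟨z, g, hg, hz⟩
    rw [Polynomial.mem_rootSet_of_ne hQne]
    have hmem : κ (LinearEquiv.smulOfUnit z) w₀ ∈ {w : W | ∀ p ∈ P, p w = 0} := by
      rw [← horb]
      exact ⟨g, by simpa using congrArg Units.val hg, hz⟩
    simpa using (hQ z).trans (hmem p hpP)
  have : Finite (Q.rootSet ℂ) := (Q.rootSet_finite ℂ).to_subtype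
  exact Finite.of_injective (fun z => (⟨_, hroot z⟩ : Q.rootSet ℂ)) fun z z' h =>
    Subtype.ext (Units.ext (congrArg Subtype.val h))

/-- The determinant has finite order on the stabilizer of `w₀`. -/
lemma IsOrbitEmbedding.exists_det_pow_eq_one [FiniteDimensional ℂ V]
    (hκ : IsOrbitEmbedding G κ w₀) :
    ∃ N : ℕ, 0 < N ∧ ∀ g ∈ stabilizerGL κ w₀, LinearEquiv.det g ^ N = 1 := by
  have := hκ.finite_orbitScalars
  refine ⟨Nat.card (orbitScalars κ w₀), Nat.card_pos, fun g hg => ?_⟩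
  rcases Nat.eq_zero_or_pos (Module.finrank ℂ V) with h0 | hpos
  · have : LinearEquiv.det g = 1 := Units.ext (by
      simpa using LinearMap.det_eq_one_of_finrank_eq_zero h0 (g : V →ₗ[ℂ] V))
    rw [this, one_pow]
  -- With z^(dim V) = det g, the element z·g⁻¹ lies in SL(V) and maps w₀ to z·w₀. So z belongs to
  -- the finite group `orbitScalars`.
  obtain ⟨z, hz⟩ := IsAlgClosed.exists_pow_nat_eq (LinearEquiv.det g : ℂ) hpos
  have hz0 : z ≠ 0 := by
    rintro rfl
    rw [zero_pow hpos.ne'] at hz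
    exact (LinearEquiv.det g).ne_zero hz.symm
  lift z to ℂˣ using hz0.isUnit
  have hdet : LinearEquiv.det (LinearEquiv.smulOfUnit z : V ≃ₗ[ℂ] V) = LinearEquiv.det g := by
    ext
    rw [← hz, LinearEquiv.coe_det]
    have : ((LinearEquiv.smulOfUnit z : V ≃ₗ[ℂ] V) : V →ₗ[ℂ] V) = (z : ℂ) • LinearMap.id := by
      ext v
      simp [LinearEquiv.smulOfUnit]
      rfl
    rw [this, LinearMap.det_smul, LinearMap.det_id, mul_one]
  have hmem : z ∈ orbitScalars κ w₀ := by
    refine ⟨LinearEquiv.smulOfUnit z * g⁻¹, by rw [map_mul, hdet, map_inv, mul_inv_cancel], ?_⟩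
    have : g⁻¹ ∈ stabilizerGL κ w₀ := inv_mem hg
    rw [map_mul, Module.End.mul_apply, show κ g⁻¹ w₀ = w₀ from this]
  have hpow : z ^ Nat.card (orbitScalars κ w₀) = 1 := by
    have := pow_card_eq_one' (x := (⟨z, hmem⟩ : orbitScalars κ w₀))
    exact congrArg Subtype.val this
  have hzu : LinearEquiv.det g = z ^ Module.finrank ℂ V := Units.ext (by simp [← hz])
  rw [hzu, ← pow_mul, mul_comm, pow_mul, hpow, one_pow]

end Stabilizer

/-! ### Surjectivity of the quotient map by G̃. -/

section LyingOver

variable {R : Type} [CommRing R] [Algebra ℂ R]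
variable {V : Type} [AddCommGroup V] [Module ℂ V]
variable {M : Type} [AddCommGroup M] [Module R M]

lemma ι_tmul_eq_smul_gen (r : R) (v : V) (m : M) :
    SymmetricAlgebra.ι R ((R ⊗[ℂ] V) ⊗[R] M) ((r ⊗ₜ[ℂ] v) ⊗ₜ[R] m) = r • gen v m := by
  rw [gen, ← map_smul, TensorProduct.smul_tmul', TensorProduct.smul_tmul', smul_eq_mul, mul_one]

@[elab_as_elim]
lemma HomAlg.induction {motive : HomAlg R V M → Prop}
    (algebraMap : ∀ r, motive (algebraMap R _ r)) (gen : ∀ v m, motive (gen v m))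
    (mul : ∀ a b, motive a → motive b → motive (a * b))
    (add : ∀ a b, motive a → motive b → motive (a + b)) (p : HomAlg R V M) : motive p := by
  induction p using SymmetricAlgebra.induction with
  | algebraMap r => exact algebraMap r
  | mul a b ha hb => exact mul a b ha hb
  | add a b ha hb => exact add a b ha hb
  | ι x =>
    induction x with
    | zero => simpa using algebraMap 0
    | add x y hx hy => rw [map_add]; exact add _ _ hx hy
    | tmul x m =>
      induction x with
      | zero => simpa using algebraMap 0
      | add x y hx hy => rw [TensorProduct.add_tmul, map_add]; exact add _ _ hx hy
      | tmul r v =>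
        rw [ι_tmul_eq_smul_gen, Algebra.smul_def]
        exact mul _ _ (algebraMap r) (gen v m)

variable (R V M) in
/-- The representation of `GL(V)` on `Sym^*(V ⊗ M)`. -/
def glRep : Representation ℂ (V ≃ₗ[ℂ] V) (HomAlg R V M) where
  toFun g := (glAct R M g).toLinearMap.restrictScalars ℂ
  map_one' := by
    ext p
    change glAct R M 1 p = p
    induction p using HomAlg.induction with
    | algebraMap r => rw [AlgHom.commutes]
    | gen v m => rw [glAct_gen]; rfl
    | mul a b ha hb => rw [map_mul, ha, hb]
    | add a b ha hb => rw [map_add, ha, hb]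
  map_mul' g g' := by
    ext p
    change glAct R M (g * g') p = glAct R M g (glAct R M g' p)
    induction p using HomAlg.induction with
    | algebraMap r => simp only [AlgHom.commutes]
    | gen v m => simp only [glAct_gen]; rfl
    | mul a b ha hb => simp only [map_mul, ha, hb]
    | add a b ha hb => simp only [map_add, ha, hb]

lemma glRep_apply (g : V ≃ₗ[ℂ] V) (p : HomAlg R V M) : glRep R V M g p = glAct R M g p := rfl

lemma glAct_mul (g g' : V ≃ₗ[ℂ] V) (p : HomAlg R V M) :
    glAct R M (g * g') p = glAct R M g (glAct R M g' p) := by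
  simp only [← glRep_apply, map_mul, Module.End.mul_apply]

/-- The generators `v ⊗ m`, as a linear function of `v`. -/
def genLeft (m : M) : V →ₗ[ℂ] HomAlg R V M where
  toFun v := gen v m
  map_add' v w := by simp only [gen, TensorProduct.tmul_add, TensorProduct.add_tmul, map_add]
  map_smul' a v := by
    rw [RingHom.id_apply, ← algebraMap_smul R a (gen v m), ← ι_tmul_eq_smul_gen,
      gen, TensorProduct.tmul_smul, TensorProduct.smul_tmul', Algebra.algebraMap_eq_smul_one]

/-- The generators `v ⊗ m`, as a linear function of `m`. -/
def genRight (v : V) : M →ₗ[R] HomAlg R V M where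
  toFun m := gen v m
  map_add' m n := by simp only [gen, TensorProduct.tmul_add, map_add]
  map_smul' a m := by simp only [gen, TensorProduct.tmul_smul, map_smul, RingHom.id_apply]

/-- On generators the orbit maps are given by matrix coefficients of g, and regular maps into an
algebra are closed under sums and products. -/
lemma isLocallyRational_glRep [FiniteDimensional ℂ V] : IsLocallyRational (glRep R V M) := by
  intro p
  simp only [glRep_apply]
  induction p using HomAlg.induction with
  | algebraMap r => simpa only [AlgHom.commutes] using const_mem_regularMaps _
  | gen v m =>
    simp only [glAct_gen]
    refine comp_mem_regularMaps (genLeft m) (f := fun g => g v) ?_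
    let b := Module.finBasis ℂ V
    have h : (fun g : V ≃ₗ[ℂ] V => g v) = ∑ i, fun g => b.coord i (g v) • b i := by
      ext g
      simp
    rw [h]
    exact sum_mem fun i _ => smul_mem_regularMaps
      (Algebra.subset_adjoin (Or.inl ⟨b.coord i, v, rfl⟩)) _
  | mul a b ha hb => simpa only [map_mul] using mul_mem_regularMaps ha hb
  | add a b ha hb =>
    convert add_mem ha hb using 1
    ext g
    simp

/-- The diagonal action on a finite power of a representation. -/
def powRep {E : Type} [AddCommGroup E] [Module ℂ E] (ρ : Representation ℂ (V ≃ₗ[ℂ] V) E) (n : ℕ) :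
    Representation ℂ (V ≃ₗ[ℂ] V) (Fin n → E) where
  toFun g := LinearMap.pi fun i => ρ g ∘ₗ LinearMap.proj i
  map_one' := by ext; simp
  map_mul' g g' := by ext; simp

lemma powRep_apply {E : Type} [AddCommGroup E] [Module ℂ E]
    (ρ : Representation ℂ (V ≃ₗ[ℂ] V) E) (n : ℕ) (g : V ≃ₗ[ℂ] V) (e : Fin n → E) (i : Fin n) :
    powRep ρ n g e i = ρ g (e i) := rfl

lemma IsLocallyRational.powRep {E : Type} [AddCommGroup E] [Module ℂ E]
    {ρ : Representation ℂ (V ≃ₗ[ℂ] V) E} (hρ : IsLocallyRational ρ) (n : ℕ) :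
    IsLocallyRational (powRep ρ n) := by
  intro e
  have h : (fun g => SingularBundle.powRep ρ n g e)
      = ∑ i, fun g => LinearMap.single ℂ (fun _ => E) i (ρ g (e i)) := by
    ext g j
    simp [powRep_apply, Finset.sum_apply, Pi.single_apply]
  rw [h]
  exact sum_mem fun i _ => comp_mem_regularMaps _ (hρ (e i))

variable {G : Subgroup (V ≃ₗ[ℂ] V)}
variable {W : Type} [AddCommGroup W] [Module ℂ W]
variable {κ : Representation ℂ (V ≃ₗ[ℂ] V) W} {w₀ : W}

/-- Averaging over the finite group `G̃/G`. -/
lemma IsOrbitEmbedding.exists_average [FiniteDimensional ℂ V] (hκ : IsOrbitEmbedding G κ w₀) :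
    ∃ A : HomAlg R V M →ₗ[R] HomAlg R V M,
      (∀ s ∈ invariants R M G, A s ∈ invariants R M (stabilizerGL κ w₀)) ∧
      (∀ s, ∀ a ∈ invariants R M (stabilizerGL κ w₀), A (s * a) = A s * a) ∧ A 1 = 1 := by
  obtain ⟨N, hN, hdet⟩ := hκ.exists_det_pow_eq_one
  -- G is the kernel of the determinant on G̃, so T is a model of G̃/G; it is finite because it
  -- consists of N-th roots of unity.
  let T : Subgroup ℂˣ := (stabilizerGL κ w₀).map LinearEquiv.det
  have hT : T ≤ rootsOfUnity N ℂ := by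
    rintro _ ⟨g, hg, rfl⟩
    exact hdet g hg
  have : NeZero N := ⟨hN.ne'⟩
  have : Finite T := Finite.of_injective _ (Subgroup.inclusion_injective hT)
  have := Fintype.ofFinite T
  have hsec : ∀ t : T, ∃ g ∈ stabilizerGL κ w₀, LinearEquiv.det g = t := fun t => t.2
  choose σ hσ hσdet using hsec
  have hcard : ((Fintype.card T : ℂ)⁻¹ * Fintype.card T) = 1 :=
    inv_mul_cancel₀ (Nat.cast_ne_zero.2 Fintype.card_ne_zero)
  refine ⟨algebraMap ℂ R (Fintype.card T : ℂ)⁻¹ • ∑ t, (glAct R M (σ t)).toLinearMap,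
    fun s hs => ?_, fun s a ha => ?_, ?_⟩
  -- On a G-invariant the action of g in G̃ depends on det g only. Hence the choice of
  -- representatives `σ` does not matter, and translating by g merely permutes the summands.
  · have key : ∀ g ∈ stabilizerGL κ w₀, ∀ g' ∈ stabilizerGL κ w₀,
        LinearEquiv.det g = LinearEquiv.det g' → glAct R M g s = glAct R M g' s := by
      intro g hg g' hg' h
      have hmem : g'⁻¹ * g ∈ G := by
        refine (hκ.stabilizer _).2 ⟨?_, mul_mem (inv_mem hg') hg⟩
        have : LinearEquiv.det (g'⁻¹ * g) = 1 := by
          rw [map_mul, map_inv, h, inv_mul_cancel]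
        rw [← LinearEquiv.coe_det, this, Units.val_one]
      have := congrArg (glAct R M g') (hs _ hmem)
      rwa [← glAct_mul, mul_inv_cancel_left] at this
    intro g hg
    simp only [LinearMap.smul_apply, LinearMap.sum_apply, AlgHom.toLinearMap_apply, map_smul,
      map_sum, ← glAct_mul]
    congr 1
    let d : T := ⟨LinearEquiv.det g, g, hg, rfl⟩
    refine Fintype.sum_equiv (Equiv.mulLeft d) _ _ fun t => ?_
    refine key _ (mul_mem hg (hσ t)) _ (hσ _) ?_
    rw [map_mul, hσdet, hσdet]
    rfl
  · simp only [LinearMap.smul_apply, LinearMap.sum_apply, AlgHom.toLinearMap_apply, map_mul,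
      ha _ (hσ _), smul_mul_assoc, Finset.sum_mul]
  · simp only [LinearMap.smul_apply, LinearMap.sum_apply, AlgHom.toLinearMap_apply, map_one,
      Finset.sum_const, Finset.card_univ, nsmul_eq_mul, mul_one]
    rw [Algebra.smul_def, ← map_natCast (algebraMap R (HomAlg R V M)),
      ← map_natCast (algebraMap ℂ R),
      ← map_mul, ← map_mul, hcard, map_one, map_one]

/-- The quotient map `Hom(V ⊗ O, M^∨) → Hom(V ⊗ O, M^∨) // G̃` is surjective. -/
lemma IsOrbitEmbedding.comap_surjective [FiniteDimensional ℂ V] (hG : IsReductive G)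
    (hκ : IsOrbitEmbedding G κ w₀) :
    Function.Surjective
      (PrimeSpectrum.comap (invariants R M (stabilizerGL κ w₀)).val.toRingHom) := by
  intro p
  -- A prime p of the invariant ring is a contraction as soon as extending and contracting it gives
  -- p back. So let b = ∑ sᵢ a'ᵢ be invariant with a'ᵢ in p; the sᵢ have to be made invariant.
  rw [← Set.mem_range, PrimeSpectrum.mem_range_comap_iff]
  refine le_antisymm (fun b hb => ?_) Ideal.le_comap_map
  rw [Ideal.mem_comap, Ideal.map, Ideal.span, Submodule.mem_span_set'] at hb
  obtain ⟨n, s, a, hsum⟩ := hb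
  choose a' ha' haa' using fun i => (a i).2
  replace haa' : ∀ i, (a i : HomAlg R V M) = a' i := fun i => (haa' i).symm
  replace hsum : ∑ i, s i * (a' i : HomAlg R V M) = b := by
    simp only [smul_eq_mul, haa'] at hsum
    exact hsum
  let L : (Fin n → HomAlg R V M) →ₗ[ℂ] HomAlg R V M :=
    ∑ i, LinearMap.mulRight ℂ (a' i : HomAlg R V M) ∘ₗ LinearMap.proj i
  have hL : ∀ e, L e = ∑ i, e i * (a' i : HomAlg R V M) := fun e => by
    simp [L, LinearMap.sum_apply]
  have hGH : ∀ g ∈ G, g ∈ stabilizerGL κ w₀ := fun g hg => ((hκ.stabilizer g).1 hg).2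
  -- The tuple s is replaced by a G-invariant one with the same sum; averaging over G̃/G then makes
  -- its entries G̃-invariant.
  obtain ⟨e, he, hLe⟩ := hG.exists_invariant (isLocallyRational_glRep.powRep n) L s (by
    intro g hg
    have h1 : L (powRep (glRep R V M) n g s) = glAct R M g (L s) := by
      simp only [hL, powRep_apply, glRep_apply, map_sum, map_mul]
      exact Finset.sum_congr rfl fun i _ => by rw [(a' i).2 g (hGH g hg)]
    rw [h1, hL, hsum]
    exact b.2 g (hGH g hg))
  obtain ⟨A, hA, hAmul, hA1⟩ := hκ.exists_average (R := R) (M := M)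
  have heG : ∀ i, e i ∈ invariants R M G := fun i g hg => by
    simpa [powRep_apply, glRep_apply] using congrFun (he g hg) i
  have hb : b = ∑ i, (⟨A (e i), hA _ (heG i)⟩ : invariants R M (stabilizerGL κ w₀)) * a' i := by
    apply Subtype.ext
    rw [hL, hL, hsum] at hLe
    have := congrArg A hLe
    rw [← one_mul (b : HomAlg R V M), hAmul _ _ b.2, hA1, one_mul, map_sum] at this
    rw [← this]
    simp [hAmul _ _ (a' _).2]
  rw [hb]
  exact sum_mem fun i _ => Ideal.mul_mem_left _ _ (ha' i)

end LyingOver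

/-! ### Alternating forms on modules of rank n over a domain. -/

section RankLemmas

variable {R : Type} [CommRing R] {M : Type} [AddCommGroup M] [Module R M] {n : ℕ}

/-- Pulled back to Rⁿ, both sides are alternating in the rows of b. They need only be compared on
injective choices of standard basis vectors, which are permutations. -/
lemma map_sum_smul_eq_det_smul {N : Type} [AddCommGroup N] [Module R N]
    (D : M [⋀^Fin n]→ₗ[R] N) (e : Fin n → M) (b : Matrix (Fin n) (Fin n) R) :
    D (fun i => ∑ j, b i j • e j) = b.det • D e := by
  let T : (Fin n → R) →ₗ[R] M := Fintype.linearCombination R e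
  have h : D.compLinearMap T
      = (LinearMap.toSpanSingleton R N (D e)).compAlternatingMap Matrix.detRowAlternating := by
    refine (Pi.basisFun R (Fin n)).ext_alternating fun v hv => ?_
    let σ : Equiv.Perm (Fin n) := Equiv.ofBijective v (Finite.injective_iff_bijective.1 hv)
    have h1 : (fun i => T (Pi.basisFun R (Fin n) (v i))) = fun i => e (σ i) := by
      ext i
      simp [T, Fintype.linearCombination_apply, Pi.single_apply, σ]
    have h2 : Matrix.det (fun i => Pi.basisFun R (Fin n) (v i)) = (Equiv.Perm.sign σ : R) := by
      rw [← Matrix.det_permutation]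
      congr 1
      ext i j
      simp [σ, Equiv.toPEquiv, Pi.single_apply, eq_comm]
    rw [AlternatingMap.compLinearMap_apply, LinearMap.compAlternatingMap_apply]
    change D (fun i => T (Pi.basisFun R (Fin n) (v i))) =
      Matrix.det (fun i => Pi.basisFun R (Fin n) (v i)) • D e
    rw [h1, h2]
    have := D.map_perm e σ
    rw [show (fun i => e (σ i)) = e ∘ σ from rfl, this, Units.smul_def, Int.cast_smul_eq_zsmul]
  have : D (fun i => T (b i)) = b.det • D e := congrArg (fun f => f b) h
  simpa [T, Fintype.linearCombination_apply] using this

variable [IsDomain R]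

/-- The n + 1 vectors x, e are dependent, and the coefficient of x in a relation cannot vanish
because e is independent. -/
lemma exists_smul_eq_sum (hM : Module.rank R M = n) {e : Fin n → M} (he : LinearIndependent R e)
    (x : M) : ∃ a : R, a ≠ 0 ∧ ∃ b : Fin n → R, a • x = ∑ i, b i • e i := by
  have hdep : ¬ LinearIndependent R (Fin.cons x e : Fin (n + 1) → M) := by
    intro h
    have := h.cardinal_le_rank
    rw [hM, Cardinal.mk_fin] at this
    have := Nat.cast_le.1 this
    omega
  rw [Fintype.not_linearIndependent_iff] at hdep
  obtain ⟨g, hg, hne⟩ := hdep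
  rw [Fin.sum_univ_succ] at hg
  simp only [Fin.cons_zero, Fin.cons_succ] at hg
  refine ⟨g 0, fun h0 => ?_, fun i => - g i.succ, ?_⟩
  · rw [h0, zero_smul, zero_add] at hg
    obtain ⟨i, hi⟩ := hne
    refine hi ?_
    refine Fin.cases h0 (fun j => ?_) i
    exact Fintype.linearIndependent_iff.1 he _ hg j
  · simp only [neg_smul, Finset.sum_neg_distrib]
    exact eq_neg_of_add_eq_zero_left hg

/-- On a module of rank `n` over a domain, all alternating `n`-forms are proportional. -/
lemma exists_alternating_proportional (hM : Module.rank R M = n) :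
    ∃ e : Fin n → M, ∀ m : Fin n → M, ∃ a b : R, a ≠ 0 ∧
      ∀ (N : Type) [AddCommGroup N] [Module R N] (D : M [⋀^Fin n]→ₗ[R] N), a • D m = b • D e := by
  obtain ⟨e, he⟩ := exists_linearIndependent_of_le_rank hM.ge
  -- Here a and b depend on m and e but not on D, so one pair serves both the coordinate form and
  -- the determinant form with values in the symmetric algebra.
  refine ⟨e, fun m => ?_⟩
  choose a ha b hb using fun i => exists_smul_eq_sum hM he (m i)
  refine ⟨∏ i, a i, Matrix.det (Matrix.of b), Finset.prod_ne_zero_iff.2 fun i _ => ha i,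
    fun N _ _ D => ?_⟩
  rw [← map_sum_smul_eq_det_smul, ← AlternatingMap.map_smul_univ]
  simp only [hb, Matrix.of_apply]

/-- Cramer's rule. -/
lemma smul_mem_span_of_alternating [Module.IsTorsionFree R M] (hM : Module.rank R M = n)
    (c : M [⋀^Fin n]→ₗ[R] R) (m : Fin n → M) (x : M) :
    c m • x ∈ Submodule.span R (Set.range m) := by
  by_cases hc : c m = 0
  · rw [hc, zero_smul]; exact zero_mem _
  have hm : LinearIndependent R m := by
    by_contra h
    exact hc (c.map_linearDependent m h)
  obtain ⟨a, ha, b, hb⟩ := exists_smul_eq_sum hM hm x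
  -- These identify the Cramer coefficients of x after scaling by a; torsion freeness then allows a
  -- to be cancelled.
  have hcoef : ∀ i, a * c (Function.update m i x) = b i * c m := by
    intro i
    rw [← smul_eq_mul, ← AlternatingMap.map_update_smul, hb, AlternatingMap.map_update_sum,
      Finset.sum_eq_single i]
    · rw [AlternatingMap.map_update_smul, Function.update_eq_self, smul_eq_mul]
    · intro j _ hj
      rw [AlternatingMap.map_update_smul, AlternatingMap.map_update_self _ _ hj.symm, smul_zero]
    · simp
  have : c m • x = ∑ i, c (Function.update m i x) • m i := by
    apply smul_right_injective M ha
    simp only [Finset.smul_sum, smul_smul, hcoef]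
    rw [mul_comm, mul_smul, hb, Finset.smul_sum]
    simp only [smul_smul, mul_comm]
  rw [this]
  exact sum_mem fun i _ => Submodule.smul_mem _ _ (Submodule.subset_span ⟨i, rfl⟩)

end RankLemmas

/-! ### The determinants det(bᵢ ⊗ mⱼ) and their invariance. -/

section DetForm

variable {R : Type} [CommRing R] [Algebra ℂ R]
variable {V : Type} [AddCommGroup V] [Module ℂ V]
variable {M : Type} [AddCommGroup M] [Module R M]
variable {n : ℕ} (b : Module.Basis (Fin n) ℂ V)

variable (R M) in
/-- The form `m ↦ det (b i ⊗ m j)` with values in `Sym^*(V ⊗ M)`. -/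
def detForm : M [⋀^Fin n]→ₗ[R] HomAlg R V M :=
  AlternatingMap.compLinearMap
    { (Matrix.detRowAlternating (n := Fin n) (R := HomAlg R V M)).toMultilinearMap.restrictScalars R
        with
      map_eq_zero_of_eq' := fun v _ _ h hij =>
        (Matrix.detRowAlternating (n := Fin n) (R := HomAlg R V M)).map_eq_zero_of_eq v h hij }
    (LinearMap.pi fun i => genRight (b i))

lemma detForm_apply (m : Fin n → M) :
    detForm R M b m = Matrix.det (Matrix.of fun j i => (gen (b i) (m j) : HomAlg R V M)) := rfl

/-- Acting by g multiplies the matrix (bᵢ ⊗ mⱼ) by the matrix of g in the basis b. -/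
lemma glAct_detForm (g : V ≃ₗ[ℂ] V) (m : Fin n → M) :
    glAct R M g (detForm R M b m)
      = algebraMap ℂ (HomAlg R V M) (LinearEquiv.det g : ℂˣ) * detForm R M b m := by
  rw [detForm_apply, AlgHom.map_det, LinearEquiv.coe_det, ← LinearMap.det_toMatrix b,
    RingHom.map_det, mul_comm, ← Matrix.det_mul]
  congr 1
  ext j i
  simp only [AlgHom.mapMatrix_apply, Matrix.map_apply, Matrix.of_apply, Matrix.mul_apply,
    RingHom.mapMatrix_apply, glAct_gen, LinearMap.toMatrix_apply]
  have h : g (b i) = ∑ k, b.repr (g (b i)) k • b k := (b.sum_repr _).symm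
  change genLeft (m j) (g (b i)) = _
  conv_lhs => rw [h]
  simp only [map_sum, map_smul, Algebra.smul_def, mul_comm]
  rfl

lemma changeRing_detForm {R' : Type} [CommRing R'] [Algebra ℂ R']
    {M' : Type} [AddCommGroup M'] [Module R' M'] (φ : R →ₐ[ℂ] R')
    (ψ : M →ₛₗ[(φ : R →+* R')] M') (m : Fin n → M) :
    changeRing φ ψ (detForm R M b m) = detForm R' M' b fun i => ψ (m i) := by
  rw [detForm_apply, detForm_apply, RingHom.map_det]
  congr 1
  ext j i
  simp [gen, changeRing_ι]

lemma prod_detForm_mem_invariants {H : Subgroup (V ≃ₗ[ℂ] V)} {N : ℕ}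
    (hN : ∀ g ∈ H, LinearEquiv.det g ^ N = 1) (l : List (Fin n → M)) (hl : l.length = N) :
    (l.map (detForm R M b)).prod ∈ invariants R M H := by
  intro g hg
  have key : ∀ l : List (Fin n → M), glAct R M g (l.map (detForm R M b)).prod
      = algebraMap ℂ (HomAlg R V M) (LinearEquiv.det g ^ l.length : ℂˣ)
        * (l.map (detForm R M b)).prod := by
    intro l
    induction l with
    | nil => simp
    | cons m l ih =>
      rw [List.map_cons, List.prod_cons, map_mul, ih, glAct_detForm, List.length_cons, pow_succ',
        Units.val_mul, map_mul]
      ring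
  rw [key, hl, hN g hg, Units.val_one, map_one, one_mul]

end DetForm

/-! ### Detecting Isom by determinants. -/

section IsomLocus

variable {R : Type} [CommRing R] [Algebra ℂ R]
variable {V : Type} [AddCommGroup V] [Module ℂ V]
variable {M : Type} [AddCommGroup M] [Module R M]
variable {n : ℕ} (b : Module.Basis (Fin n) ℂ V)

/-- The vectors (φᵢ(x))ᵢ span Kⁿ, since a nonzero functional vanishing on them would be a linear
relation among the φᵢ. Any n of them that form a basis give the points. -/
lemma exists_det_ne_zero_of_linearIndependent {K : Type} [Field K] {X : Type} {n : ℕ}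
    {φ : Fin n → X → K} (hφ : LinearIndependent K φ) :
    ∃ x : Fin n → X, Matrix.det (Matrix.of fun j i => φ i (x j)) ≠ 0 := by
  let s : Set (Fin n → K) := Set.range fun x i => φ i x
  have hs : Submodule.span K s = ⊤ := by
    by_contra h
    obtain ⟨f, hf0, hf⟩ := Submodule.exists_le_ker_of_lt_top _ (lt_top_iff_ne_top.2 h)
    apply hf0
    have hzero : ∀ i, f (Pi.single i 1) = 0 := by
      refine Fintype.linearIndependent_iff.1 hφ (fun i => f (Pi.single i 1)) ?_
      ext x
      have hx : f (fun i => φ i x) = 0 := hf (Submodule.subset_span ⟨x, rfl⟩)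
      rw [pi_eq_sum_univ' (fun i => φ i x), map_sum] at hx
      simp only [map_smul, smul_eq_mul] at hx
      simp only [Finset.sum_apply, Pi.smul_apply, smul_eq_mul, Pi.zero_apply]
      rw [← hx]
      refine Finset.sum_congr rfl fun i _ => ?_
      rw [mul_comm]
    exact LinearMap.pi_ext' fun i => LinearMap.ext_ring (hzero i)
  obtain ⟨f, hfs, -, hf⟩ := Submodule.exists_fun_fin_finrank_span_eq K s
  have hn : Module.finrank K (Submodule.span K s) = n := by
    rw [hs, finrank_top, Module.finrank_fin_fun]
  choose x hx using hfs
  refine ⟨fun j => x (Fin.cast hn.symm j), ?_⟩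
  have hf' : LinearIndependent K (Matrix.row
      (Matrix.of fun j i => φ i (x (Fin.cast hn.symm j)))) := by
    have h : Matrix.row (Matrix.of fun j i => φ i (x (Fin.cast hn.symm j)))
        = f ∘ Fin.cast hn.symm := funext fun j => hx _
    rw [h]
    exact hf.comp _ (Fin.cast_injective _)
  rw [Matrix.linearIndependent_rows_iff_isUnit, Matrix.isUnit_iff_isUnit_det] at hf'
  exact hf'.ne_zero

variable (q : PrimeSpectrum (HomAlg R V M))

/-- The basis of `V ⊗ κ(q)` induced by a basis of `V`. -/
def residueBasis : Module.Basis (Fin n) q.asIdeal.ResidueField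
    (q.asIdeal.ResidueField ⊗[R] (R ⊗[ℂ] V)) :=
  (b.baseChange R).baseChange q.asIdeal.ResidueField

lemma universalHom_residueBasis (i : Fin n) (m : M) :
    universalHom q (residueBasis b q i) m
      = algebraMap (HomAlg R V M) q.asIdeal.ResidueField (gen (b i) m) := by
  rw [residueBasis, Module.Basis.baseChange_apply, Module.Basis.baseChange_apply,
    universalHom_tmul]

lemma algebraMap_detForm (m : Fin n → M) :
    algebraMap (HomAlg R V M) q.asIdeal.ResidueField (detForm R M b m)
      = Matrix.det (Matrix.of fun j i => universalHom q (residueBasis b q i) (m j)) := by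
  rw [detForm_apply, RingHom.map_det]
  congr 1
  ext j i
  simp [universalHom_residueBasis]

lemma detForm_mem_iff (m : Fin n → M) : detForm R M b m ∈ q.asIdeal ↔
    Matrix.det (Matrix.of fun j i => universalHom q (residueBasis b q i) (m j)) = 0 := by
  rw [← algebraMap_detForm, Ideal.algebraMap_residueField_eq_zero]

lemma exists_detForm_notMem_of_mem_isomLocus (hq : q ∈ isomLocus R V M) :
    ∃ m : Fin n → M, detForm R M b m ∉ q.asIdeal := by
  have hinj : Function.Injective (universalHom q) := hq.1
  have h : LinearIndependent q.asIdeal.ResidueField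
      (fun i (m : M) => universalHom q (residueBasis b q i) m) := by
    rw [Fintype.linearIndependent_iff]
    intro α hα
    refine Fintype.linearIndependent_iff.1 (residueBasis b q).linearIndependent α ?_
    apply hinj
    ext m
    simpa using congrFun hα m
  obtain ⟨m, hm⟩ := exists_det_ne_zero_of_linearIndependent h
  exact ⟨m, fun h => hm ((detForm_mem_iff b q m).1 h)⟩

/-- The values on m of the universal homomorphism are given by an invertible matrix B. A
homomorphism to κ(q) is determined by its values on m, because r is invertible in κ(q) and r·M lies
in the span of m. -/
lemma mem_isomLocus_of_detForm_notMem (m : Fin n → M) (hm : detForm R M b m ∉ q.asIdeal) (r : R)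
    (hr : algebraMap R (HomAlg R V M) r ∉ q.asIdeal)
    (hspan : ∀ x : M, r • x ∈ Submodule.span R (Set.range m)) : q ∈ isomLocus R V M := by
  rw [detForm_mem_iff] at hm
  set B := Matrix.of fun j i => universalHom q (residueBasis b q i) (m j) with hB
  have hr' : algebraMap R q.asIdeal.ResidueField r ≠ 0 := by
    rw [IsScalarTower.algebraMap_apply R (HomAlg R V M), Ne, Ideal.algebraMap_residueField_eq_zero]
    exact hr
  have happly : ∀ (α : Fin n → q.asIdeal.ResidueField) (j : Fin n),
      universalHom q (∑ i, α i • residueBasis b q i) (m j) = B.mulVec α j := by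
    intro α j
    simp [hB, Matrix.mulVec, dotProduct, mul_comm]
  constructor
  · rw [injective_iff_map_eq_zero]
    intro y hy
    rw [← (residueBasis b q).sum_repr y] at hy ⊢
    have h0 : B.mulVec ((residueBasis b q).repr y) = 0 := by
      ext j
      rw [← happly, hy]
      rfl
    rw [Matrix.eq_zero_of_mulVec_eq_zero hm h0]
    simp
  · intro φ
    have hu : IsUnit B.det := isUnit_iff_ne_zero.2 hm
    -- The coefficients for which the universal homomorphism agrees with φ on m.
    let α := B⁻¹.mulVec fun j => φ (m j)
    refine ⟨∑ i, α i • residueBasis b q i, ?_⟩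
    rw [← sub_eq_zero]
    set ψ := universalHom q (∑ i, α i • residueBasis b q i) - φ with hψ
    have hψm : ∀ j, ψ (m j) = 0 := by
      intro j
      rw [hψ, LinearMap.sub_apply, happly, Matrix.mulVec_mulVec, Matrix.mul_nonsing_inv _ hu,
        Matrix.one_mulVec, sub_self]
    ext x
    have hker : Submodule.span R (Set.range m) ≤ LinearMap.ker ψ := by
      rw [Submodule.span_le]
      rintro _ ⟨j, rfl⟩
      exact hψm j
    have := hker (hspan x)
    rw [LinearMap.mem_ker, map_smul, Algebra.smul_def] at this
    exact (mul_eq_zero.1 this).resolve_left hr'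

end IsomLocus

/-! ### Extending sections of quasi-coherent sheaves from basic open sets. -/

section Extension

variable {X : Scheme.{0}}

/-- Sections over D(f) are the localization at f, so f^k·s extends for some k, and f is invertible
on D(f). -/
lemma exists_resM_restrict_eq_unit_smul {R : CommRingCat.{0}} (ψ : Spec R ⟶ X) [IsOpenImmersion ψ]
    (A : X.Modules) [A.IsQuasicoherent] (f : R)
    (h : ψ ''ᵁ (PrimeSpectrum.basicOpen f) ≤ ψ ''ᵁ ⊤)
    (s : Γ(A, ψ ''ᵁ (PrimeSpectrum.basicOpen f))) :
    ∃ (t : Γ(A, ψ ''ᵁ ⊤)) (u : Γ(X, ψ ''ᵁ (PrimeSpectrum.basicOpen f))),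
      IsUnit u ∧ resM A h t = u • s := by
  have hloc : IsLocalizing (modulesSpecToSheaf.obj (A.restrict ψ)) :=
    (isIso_fromTildeΓ_iff_isLocalizing (A.restrict ψ)).1 inferInstance
  have hf := hloc f
  obtain ⟨⟨t, ⟨_, k, rfl⟩⟩, ht⟩ := hf.surj s
  refine ⟨t, (ψ.appIso (PrimeSpectrum.basicOpen f)).inv
    (((Spec R).presheaf.map (homOfLE le_top).op) ((Scheme.ΓSpecIso R).inv (f ^ k))), ?_, ?_⟩
  · apply IsUnit.map (ψ.appIso (PrimeSpectrum.basicOpen f)).inv.hom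
    let D : (Spec R).Opens := PrimeSpectrum.basicOpen f
    have : IsUnit (algebraMap R Γ(Spec R, D) f) := IsLocalization.Away.algebraMap_isUnit _
    have := this.pow k
    rw [← map_pow] at this
    exact this
  · exact ht.symm

lemma exists_resM_eq_unit_smul (A : X.Modules) [A.IsQuasicoherent] {W : X.Opens}
    (hW : IsAffineOpen W) (f : Γ(X, W)) (s : Γ(A, X.basicOpen f)) :
    ∃ (t : Γ(A, W)) (u : Γ(X, X.basicOpen f)),
      IsUnit u ∧ resM A (X.basicOpen_le f) t = u • s := by
  have key : ∀ (W₀ D₀ : X.Opens) (_ : W₀ = W) (_ : D₀ = X.basicOpen f) (h : D₀ ≤ W₀),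
      (∀ s : Γ(A, D₀), ∃ (t : Γ(A, W₀)) (u : Γ(X, D₀)), IsUnit u ∧ resM A h t = u • s) →
      ∃ (t : Γ(A, W)) (u : Γ(X, X.basicOpen f)),
        IsUnit u ∧ resM A (X.basicOpen_le f) t = u • s := by
    rintro W₀ D₀ rfl rfl h hs
    exact hs s
  refine key (hW.fromSpec ''ᵁ ⊤) (hW.fromSpec ''ᵁ (PrimeSpectrum.basicOpen f)) ?_ ?_
    (Scheme.Hom.image_mono _ le_top) (exists_resM_restrict_eq_unit_smul hW.fromSpec A f _)
  · simp
  · exact hW.fromSpec_image_basicOpen f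

end Extension

/-! ### Coordinates with respect to a generator of det A. -/

section Coordinates

variable {X : Scheme.{0}} {A : X.Modules} {n : ℕ}

lemma resO_self {W : X.Opens} (h : W ≤ W) (f : Γ(X, W)) : resO h f = f := by
  change X.presheaf.map (𝟙 _) f = f
  simp

lemma resM_resM {W W' W'' : X.Opens} (h : W' ≤ W) (h' : W'' ≤ W') (x : Γ(A, W)) :
    resM A h' (resM A h x) = resM A (h'.trans h) x := by
  change A.presheaf.map _ (A.presheaf.map _ x) = A.presheaf.map _ x
  rw [← CategoryTheory.comp_apply, ← Functor.map_comp]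
  rfl

lemma resM_update {W W' : X.Opens} (h : W' ≤ W) [DecidableEq (Fin n)] (m : Fin n → Γ(A, W))
    (i : Fin n) (x : Γ(A, W)) :
    (fun j => resM A h (Function.update m i x j))
      = Function.update (fun j => resM A h (m j)) i (resM A h x) := by
  ext j
  exact Function.apply_update (fun _ => resM A h) m i x j

/-- The section `m 0 ∧ ⋯ ∧ m (n - 1)` of `det A`. -/
def wedge {W : X.Opens} (m : Fin n → Γ(A, W)) : DetSection A n W where
  eval W' h ω := ω.form W' le_rfl fun i => resM A h (m i)
  add _ _ _ _ := rfl
  smul W' h f ω := by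
    change resO le_rfl f * _ = _
    rw [resO_self]
    rfl
  res W' W'' h' h ω := by
    rw [← ω.res W' W'' le_rfl h]
    simp only [resM_resM]
    rfl

/-- `det A` is trivialized by its section `s`. -/
def IsDetGenerator (s : DetSection A n ⊤) : Prop :=
  ∀ (W : X.Opens) (t : DetSection A n W), ∃! f : Γ(X, W),
    ∀ (W' : X.Opens) (h : W' ≤ W) (ω : AltForm A n W'),
      t.eval W' h ω = resO h f * s.eval W' le_top ω

namespace IsDetGenerator

variable {s : DetSection A n ⊤} (hs : IsDetGenerator s)

/-- The coordinate of `m 0 ∧ ⋯ ∧ m (n - 1)` with respect to the generator `s`. -/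
def coord {W : X.Opens} (m : Fin n → Γ(A, W)) : Γ(X, W) := (hs W (wedge m)).choose

lemma form_eq {W W' : X.Opens} (m : Fin n → Γ(A, W)) (h : W' ≤ W) (ω : AltForm A n W') :
    ω.form W' le_rfl (fun i => resM A h (m i)) = resO h (hs.coord m) * s.eval W' le_top ω :=
  (hs W (wedge m)).choose_spec.1 W' h ω

lemma form_eq_self {W : X.Opens} (m : Fin n → Γ(A, W)) (ω : AltForm A n W) :
    ω.form W le_rfl m = hs.coord m * s.eval W le_top ω := by
  have := hs.form_eq m le_rfl ω
  rw [resO_self] at this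
  rw [← this]
  congr 1
  ext i
  change m i = A.presheaf.map (𝟙 _) (m i)
  simp

/-- The uniqueness half of the generator property; compatibility of `coord` with restriction and its
multilinearity follow from it. -/
lemma coord_eq {W : X.Opens} {m : Fin n → Γ(A, W)} {f : Γ(X, W)}
    (h : ∀ (W' : X.Opens) (h : W' ≤ W) (ω : AltForm A n W'),
      ω.form W' le_rfl (fun i => resM A h (m i)) = resO h f * s.eval W' le_top ω) :
    hs.coord m = f :=
  ((hs W (wedge m)).choose_spec.2 f h).symm

lemma coord_res {W W' : X.Opens} (h : W' ≤ W) (m : Fin n → Γ(A, W)) :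
    hs.coord (fun i => resM A h (m i)) = resO h (hs.coord m) := by
  refine hs.coord_eq fun W'' h' ω => ?_
  simp only [resM_resM, resO_resO]
  exact hs.form_eq m _ ω

variable (W : X.Opens) in
/-- `coord` as an alternating form. -/
def coordForm : Γ(A, W) [⋀^Fin n]→ₗ[Γ(X, W)] Γ(X, W) where
  toFun m := hs.coord m
  map_update_add' m i x y := hs.coord_eq fun W' h ω => by
    rw [resM_update, map_add (resM A h), AlternatingMap.map_update_add, map_add, add_mul,
      ← resM_update, ← resM_update, hs.form_eq, hs.form_eq]
  map_update_smul' m i a x := hs.coord_eq fun W' h ω => by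
    rw [resM_update, LinearMap.map_smulₛₗ, AlternatingMap.map_update_smul, ← resM_update,
      hs.form_eq, smul_eq_mul, smul_eq_mul, map_mul, mul_assoc]
  map_eq_zero_of_eq' m i j hm hij := hs.coord_eq fun W' h ω => by
    rw [map_zero, zero_mul]
    exact AlternatingMap.map_eq_zero_of_eq _ _ (congrArg (resM A h) hm) hij

lemma coordForm_apply {W : X.Opens} (m : Fin n → Γ(A, W)) :
    hs.coordForm W m = hs.coord m := rfl

end IsDetGenerator

/-- The restrictions of the sections `e i` form bases over all open subsets of `W`. -/
def IsSheafBasis {W : X.Opens} (e : Fin n → Γ(A, W)) : Prop :=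
  ∀ (W' : X.Opens) (h : W' ≤ W), LinearIndependent Γ(X, W') (fun i => resM A h (e i)) ∧
    Submodule.span Γ(X, W') (Set.range fun i => resM A h (e i)) = ⊤

namespace IsSheafBasis

variable {W : X.Opens} {e : Fin n → Γ(A, W)}

lemma res (he : IsSheafBasis e) {W' : X.Opens} (h : W' ≤ W) :
    IsSheafBasis fun i => resM A h (e i) := by
  intro W'' h'
  simpa only [resM_resM] using he W'' (h'.trans h)

variable (he : IsSheafBasis e)

/-- The basis of the sections over an open subset. -/
def basis {W' : X.Opens} (h : W' ≤ W) : Module.Basis (Fin n) Γ(X, W') Γ(A, W') :=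
  .mk (he W' h).1 (he W' h).2.ge

lemma basis_apply {W' : X.Opens} (h : W' ≤ W) (i : Fin n) : he.basis h i = resM A h (e i) := by
  simp [basis]

lemma basis_repr_res {W' W'' : X.Opens} (h : W' ≤ W) (h' : W'' ≤ W') (x : Γ(A, W')) (i : Fin n) :
    (he.basis (h'.trans h)).repr (resM A h' x) i = resO h' ((he.basis h).repr x i) := by
  have hx : resM A h' x
      = ∑ j, resO h' ((he.basis h).repr x j) • he.basis (h'.trans h) j := by
    conv_lhs => rw [← (he.basis h).sum_repr x]
    rw [map_sum]
    refine Finset.sum_congr rfl fun j _ => ?_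
    rw [LinearMap.map_smulₛₗ, basis_apply, basis_apply, resM_resM]
  rw [hx, Module.Basis.repr_sum_self]

/-- The determinant with respect to a basis. -/
def det : AltForm A n W where
  form W' h := (he.basis h).det
  res W' W'' h' h v := by
    rw [Module.Basis.det_apply, Module.Basis.det_apply, RingHom.map_det]
    congr 1
    ext i j
    exact he.basis_repr_res h' h (v j) i

/-- Evaluating e₀ ∧ ⋯ ∧ eₙ₋₁ = coord(e)·s at the determinant form of the basis gives 1 =
coord(e)·s(det). -/
lemma isUnit_coord (he : IsSheafBasis e) {s : DetSection A n ⊤} (hs : IsDetGenerator s) :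
    IsUnit (hs.coord e) := by
  refine IsUnit.of_mul_eq_one (s.eval W le_top he.det) ?_
  rw [← hs.form_eq_self]
  have : e = he.basis le_rfl := by
    ext i
    rw [basis_apply]
    change e i = A.presheaf.map (𝟙 _) (e i)
    simp
  exact (congrArg (he.basis le_rfl).det this).trans (Module.Basis.det_self _)

end IsSheafBasis

end Coordinates

/-! ### Regularity of rational functions on an integral scheme. -/

section FunctionField

variable {X : Scheme.{0}} [IsIntegral X]

/-- The value of a function at the generic point. -/
def toK (W : X.Opens) [Nonempty W] : Γ(X, W) →+* X.functionField :=
  (X.germToFunctionField W).hom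

lemma toK_injective (W : X.Opens) [Nonempty W] : Function.Injective (toK W) :=
  X.germToFunctionField_injective W

lemma toK_resO {W W' : X.Opens} [Nonempty W] [Nonempty W'] (h : W' ≤ W) (f : Γ(X, W)) :
    toK W' (resO h f) = toK W f :=
  X.presheaf.germ_res_apply (homOfLE h) _ _ f

lemma nonempty_inf (W W' : X.Opens) [hW : Nonempty W] [hW' : Nonempty W'] :
    Nonempty (W ⊓ W' : X.Opens) := by
  obtain ⟨x, hx, hy⟩ := nonempty_preirreducible_inter W.isOpen W'.isOpen
    (Set.nonempty_coe_sort.1 hW) (Set.nonempty_coe_sort.1 hW')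
  exact ⟨⟨x, hx, hy⟩⟩

/-- A rational function which is regular on the affine open subsets of `W` is regular on `W`. -/
lemma exists_toK_eq_of_affine (W : X.Opens) [Nonempty W] (a : X.functionField)
    (h : ∀ W' : X.Opens, W' ≤ W → IsAffineOpen W' → ∀ [Nonempty W'], ∃ f, toK W' f = a) :
    ∃ f, toK W f = a := by
  let ι := {W' : X.Opens // W' ≤ W ∧ IsAffineOpen W' ∧ Nonempty W'}
  have hι : ∀ i : ι, Nonempty i.1 := fun i => i.2.2.2
  choose sf hsf using fun i : ι => h i.1 i.2.1 i.2.2.1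
  obtain ⟨f, hf, -⟩ := TopCat.Sheaf.existsUnique_gluing' X.sheaf (fun i : ι => i.1) W
    (fun i => homOfLE i.2.1) (by
      intro x hx
      obtain ⟨_, ⟨W', hW', rfl⟩, hxW', hle⟩ :=
        X.isBasis_affineOpens.exists_subset_of_mem_open hx W.isOpen
      exact TopologicalSpace.Opens.mem_iSup.2 ⟨⟨W', hle, hW', ⟨⟨x, hxW'⟩⟩⟩, hxW'⟩) sf (by
      intro i j
      have := nonempty_inf i.1 j.1
      apply toK_injective (i.1 ⊓ j.1)
      exact (toK_resO inf_le_left (sf i)).trans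
        ((hsf i).trans ((hsf j).symm.trans (toK_resO inf_le_right (sf j)).symm)))
  obtain ⟨⟨x, hx⟩⟩ := ‹Nonempty W›
  obtain ⟨_, ⟨W', hW', rfl⟩, hxW', hle⟩ :=
    X.isBasis_affineOpens.exists_subset_of_mem_open hx W.isOpen
  have hne : Nonempty W' := ⟨⟨x, hxW'⟩⟩
  let i : ι := ⟨W', hle, hW', hne⟩
  refine ⟨f, ?_⟩
  rw [← hsf i, ← hf i]
  exact (toK_resO (W' := W') hle f).symm

variable {A : X.Modules} {n : ℕ} {s : DetSection A n ⊤} (hs : IsDetGenerator s)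

lemma IsDetGenerator.toK_prod_coord_res {W W' : X.Opens} [Nonempty W] [Nonempty W'] (h : W' ≤ W)
    (l : List (Fin n → Γ(A, W))) :
    toK W' ((l.map fun m i => resM A h (m i)).map hs.coord).prod
      = toK W (l.map hs.coord).prod := by
  rw [← toK_resO h, map_list_prod (resO h), List.map_map, List.map_map]
  congr 3
  funext m
  exact hs.coord_res h m

/-- As `det A` is trivialized by `s`, a rational function `a` is regular if its products with the
coordinates of all `m 0 ∧ ⋯ ∧ m (n - 1)` are regular: evaluate `s` at the form `a • coord`. -/
lemma IsDetGenerator.exists_toK_eq {W₀ : X.Opens} [Nonempty W₀] {e : Fin n → Γ(A, W₀)}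
    (he : IsSheafBasis e) (W : X.Opens) [Nonempty W] (a : X.functionField)
    (h : ∀ W' : X.Opens, W' ≤ W → IsAffineOpen W' → ∀ [Nonempty W'] (m : Fin n → Γ(A, W')),
      ∃ f, toK W' f = a * toK W' (hs.coord m)) :
    ∃ f, toK W f = a := by
  -- The values of the form a·coord. On an empty open set the value is irrelevant, so nonemptiness
  -- is only required for the equation.
  have hex : ∀ W' : X.Opens, W' ≤ W → ∀ m : Fin n → Γ(A, W'),
      ∃ f, ∀ [Nonempty W'], toK W' f = a * toK W' (hs.coord m) := by
    intro W' hW' m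
    by_cases hne : Nonempty W'
    · obtain ⟨f, hf⟩ := exists_toK_eq_of_affine W' (a * toK W' (hs.coord m)) (by
        intro W'' h' haff _
        obtain ⟨f, hf⟩ := h W'' (h'.trans hW') haff fun i => resM A h' (m i)
        exact ⟨f, by rw [hf, hs.coord_res, toK_resO]⟩)
      exact ⟨f, hf⟩
    · exact ⟨0, fun {h} => (hne h).elim⟩
  have huniq : ∀ (W' : X.Opens) (f f' : Γ(X, W')), (∀ [Nonempty W'], toK W' f = toK W' f') →
      f = f' := by
    intro W' f f' hff'
    by_cases hne : Nonempty W'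
    · exact toK_injective W' hff'
    · have : W' = ⊥ := by
        rw [eq_bot_iff]
        intro x hx
        exact (hne ⟨⟨x, hx⟩⟩).elim
      subst this
      exact Subsingleton.elim _ _
  choose φ hφ using hex
  let ω : AltForm A n W :=
    { form W' h' :=
        { toFun := φ W' h'
          map_update_add' := fun m i x y => huniq _ _ _ fun {_} => by
            rw [map_add, hφ, hφ, hφ, ← mul_add, ← map_add, ← hs.coordForm_apply,
              ← hs.coordForm_apply, ← hs.coordForm_apply, AlternatingMap.map_update_add]
          map_update_smul' := fun m i c x => huniq _ _ _ fun {_} => by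
            rw [smul_eq_mul, map_mul, hφ, hφ, ← hs.coordForm_apply, ← hs.coordForm_apply,
              AlternatingMap.map_update_smul, smul_eq_mul, map_mul]
            ring
          map_eq_zero_of_eq' := fun m i j hm hij => huniq _ _ _ fun {_} => by
            rw [hφ, ← hs.coordForm_apply, AlternatingMap.map_eq_zero_of_eq _ _ hm hij, map_zero,
              mul_zero] }
      res := fun W' W'' h' h'' m => huniq _ _ _ fun {_} => by
        have : Nonempty W' := ‹Nonempty W''›.map fun x => ⟨x.1, h'' x.2⟩
        rw [toK_resO]
        exact (hφ _ _ _).trans (by rw [hs.coord_res, toK_resO, ← hφ W' h']; rfl) }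
  -- Over W ⊓ W₀ the value of ω at e is both a·coord(e) and coord(e)·s(ω); coord(e) is a unit there
  -- and cancels, so s(ω) = a.
  refine ⟨s.eval W le_top ω, ?_⟩
  have := nonempty_inf W W₀
  have he' := he.res (inf_le_right : W ⊓ W₀ ≤ W₀)
  have h1 := hs.form_eq_self (fun i => resM A inf_le_right (e i)) (ω.restrict inf_le_left)
  have h2 : s.eval (W ⊓ W₀) le_top (ω.restrict inf_le_left)
      = resO inf_le_left (s.eval W le_top ω) := s.res W (W ⊓ W₀) le_top inf_le_left ω
  have h3 := congrArg (toK (W ⊓ W₀)) h1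
  rw [h2, map_mul, toK_resO] at h3
  have h4 := (hφ (W ⊓ W₀) inf_le_left (fun i => resM A inf_le_right (e i))).symm.trans h3
  rw [mul_comm] at h4
  exact (mul_left_cancel₀ ((he'.isUnit_coord hs).map (toK (W ⊓ W₀))).ne_zero h4).symm

end FunctionField

/-! ### Sections forming a basis at a point of the locally free locus. -/

section LocallyFree

variable {X : Scheme.{0}}

/-- Local freeness supplies a basis of unspecified size; on an affine neighbourhood the rank
condition forces this size to be n. -/
lemma IsTorsionFreeOfRank.exists_isSheafBasis {A : X.Modules} {n : ℕ}
    (hA : IsTorsionFreeOfRank A n) {x : X} (hx : x ∈ locallyFreeLocus A) :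
    ∃ (W : X.Opens) (e : Fin n → Γ(A, W)), IsAffineOpen W ∧ x ∈ W ∧ IsSheafBasis e := by
  rw [locallyFreeLocus, TopologicalSpace.Opens.mem_sSup] at hx
  obtain ⟨W₁, ⟨k, e, he⟩, hxW₁⟩ := hx
  replace he : IsSheafBasis e := he
  obtain ⟨_, ⟨W, hW, rfl⟩, hxW, hle⟩ :=
    X.isBasis_affineOpens.exists_subset_of_mem_open hxW₁ W₁.isOpen
  have hrank := hA.rank W hW ⟨x, hxW⟩
  have : Nonempty W := ⟨⟨x, hxW⟩⟩
  rw [rank_eq_card_basis (he.basis hle), Fintype.card_fin, Nat.cast_inj] at hrank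
  subst hrank
  exact ⟨W, _, hW, hxW, he.res hle⟩

lemma notMem_primeIdealOf_of_isUnit_resO {W D : X.Opens} (hW : IsAffineOpen W) (x : W)
    (h : D ≤ W) (hx : x.1 ∈ D) {g : Γ(X, W)} (hg : IsUnit (resO h g)) :
    g ∉ (hW.primeIdealOf x).asIdeal := by
  have hmem : x.1 ∈ X.basicOpen g := by
    have h1 := X.basicOpen_res g (homOfLE h).op
    have h2 : X.basicOpen (resO h g) = D := X.basicOpen_of_isUnit hg
    have h3 : D ⊓ X.basicOpen g = D := h1.symm.trans h2
    exact (inf_eq_left.1 h3) hx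
  rw [← hW.fromSpec_primeIdealOf x] at hmem
  change hW.primeIdealOf x ∈ hW.fromSpec ⁻¹ᵁ X.basicOpen g at hmem
  rw [hW.fromSpec_preimage_basicOpen] at hmem
  exact hmem

/-- Over an affine neighbourhood of a point at which `A` is locally free, there are sections which
form a basis of `A` at this point. -/
lemma IsTorsionFreeOfRank.exists_coord_notMem {A : X.Modules} {n : ℕ}
    (hA : IsTorsionFreeOfRank A n) {s : DetSection A n ⊤} (hs : IsDetGenerator s)
    {W : X.Opens} (hW : IsAffineOpen W) (x : W) (hx : x.1 ∈ locallyFreeLocus A) :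
    ∃ m : Fin n → Γ(A, W), hs.coord m ∉ (hW.primeIdealOf x).asIdeal := by
  have := hA.quasicoherent
  obtain ⟨W₁, e, -, hxW₁, he⟩ := hA.exists_isSheafBasis hx
  obtain ⟨f, hfle, hxf⟩ := hW.exists_basicOpen_le (V := W₁) ⟨x.1, hxW₁⟩ x.2
  -- On D(f) the extended sections are unit multiples of a basis, so their coordinate is a unit
  -- there and does not vanish at x.
  choose m u hu hm using fun i =>
    exists_resM_eq_unit_smul A hW f (resM A hfle (e i))
  refine ⟨m, notMem_primeIdealOf_of_isUnit_resO hW x (X.basicOpen_le f) hxf ?_⟩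
  rw [← hs.coord_res, ← hs.coordForm_apply]
  simp only [hm]
  rw [AlternatingMap.map_smul_univ, smul_eq_mul]
  refine IsUnit.mul ?_ ((he.res hfle).isUnit_coord hs)
  exact IsUnit.prod_univ_iff.2 hu

end LocallyFree

/-! ### Evaluating τ on products of N determinants. -/

section Bundle


variable {X : Scheme.{0}} [X.Over (Spec (CommRingCat.of ℂ))]
variable {V : Type} [AddCommGroup V] [Module ℂ V] [FiniteDimensional ℂ V]
variable {H : Subgroup (V ≃ₗ[ℂ] V)}

namespace SingularPrincipalBundle

variable (B : SingularPrincipalBundle X H) {N : ℕ}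
  (hN : ∀ g ∈ H, LinearEquiv.det g ^ N = 1)

/-- The image under `τ` of a product of `N` determinants. -/
def tauDet {W : X.Opens} (hW : IsAffineOpen W)
    (l : List (Fin (Module.finrank ℂ V) → Γ(B.A, W))) (hl : l.length = N) : Γ(X, W) :=
  B.τ W hW ⟨_, prod_detForm_mem_invariants (Module.finBasis ℂ V) hN l hl⟩

lemma tauDet_res {W W' : X.Opens} (hW : IsAffineOpen W) (hW' : IsAffineOpen W') (h : W' ≤ W)
    (l : List (Fin (Module.finrank ℂ V) → Γ(B.A, W))) (hl : l.length = N) :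
    B.tauDet hN hW' (l.map fun m i => resM B.A h (m i)) (by simpa using hl)
      = resO h (B.tauDet hN hW l hl) := by
  rw [tauDet, tauDet, ← B.τ_res W W' hW hW' h]
  congr 1
  apply Subtype.ext
  change ((l.map fun m i => resM B.A h (m i)).map (detForm _ _ _)).prod
    = changeRing (resAlg h) (resM B.A h) (l.map (detForm _ _ _)).prod
  rw [map_list_prod, List.map_map, List.map_map]
  congr 2
  funext m
  exact (changeRing_detForm (Module.finBasis ℂ V) (resAlg h) (resM B.A h) m).symm

variable [IsIntegral X] {s : DetSection B.A (Module.finrank ℂ V) ⊤} (hs : IsDetGenerator s)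

/-- The quotient of `tauDet` by the product of coordinates does not depend on the sections; it is
cross-multiplied to avoid denominators. By proportionality both reduce to a reference family e with
the same factors ∏ a and ∏ b. -/
lemma tauDet_mul_prod_coord {W : X.Opens} (hW : IsAffineOpen W) [hne : Nonempty W]
    (l l' : List (Fin (Module.finrank ℂ V) → Γ(B.A, W))) (hl : l.length = N)
    (hl' : l'.length = N) :
    B.tauDet hN hW l hl * (l'.map hs.coord).prod
      = B.tauDet hN hW l' hl' * (l.map hs.coord).prod := by
  obtain ⟨e, he⟩ := exists_alternating_proportional
    (B.torsionFree.rank W hW (Set.nonempty_coe_sort.1 hne))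
  choose a b ha hab using he
  have hcoord : ∀ l : List (Fin (Module.finrank ℂ V) → Γ(B.A, W)),
      (l.map a).prod * (l.map hs.coord).prod
        = (l.map b).prod * (hs.coord e) ^ l.length := by
    intro l
    induction l with
    | nil => simp
    | cons m l ih =>
      have h1 : a m * hs.coord m = b m * hs.coord e := hab m _ (hs.coordForm W)
      simp only [List.map_cons, List.prod_cons, List.length_cons, pow_succ]
      linear_combination h1 * ((l.map a).prod * (l.map hs.coord).prod) + b m * hs.coord e * ih
  have hdet : ∀ l : List (Fin (Module.finrank ℂ V) → Γ(B.A, W)),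
      (l.map a).prod • (l.map (detForm Γ(X, W) Γ(B.A, W) (Module.finBasis ℂ V))).prod
        = (l.map b).prod • ((List.replicate l.length e).map
          (detForm Γ(X, W) Γ(B.A, W) (Module.finBasis ℂ V))).prod := by
    intro l
    induction l with
    | nil => simp
    | cons m l ih =>
      have h1 := hab m _ (detForm Γ(X, W) Γ(B.A, W) (Module.finBasis ℂ V))
      simp only [List.map_cons, List.prod_cons, List.length_cons, List.replicate_succ]
      rw [← smul_mul_smul_comm, h1, ih, smul_mul_smul_comm]
  have htau : ∀ (l : List (Fin (Module.finrank ℂ V) → Γ(B.A, W))) (hl : l.length = N),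
      (l.map a).prod * B.tauDet hN hW l hl
        = (l.map b).prod * B.tauDet hN hW (List.replicate N e) (List.length_replicate ..) := by
    intro l hl
    subst hl
    rw [← smul_eq_mul, ← smul_eq_mul, tauDet, tauDet, ← map_smul, ← map_smul]
    congr 1
    exact Subtype.ext (hdet l)
  have hne0 : ∀ l : List (Fin (Module.finrank ℂ V) → Γ(B.A, W)), (l.map a).prod ≠ 0 := by
    intro l
    refine List.prod_ne_zero ?_
    simpa using fun x _ => ha x
  apply mul_left_cancel₀ (hne0 l)
  apply mul_left_cancel₀ (hne0 l')
  have h1 := hcoord l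
  have h2 := hcoord l'
  have h3 := htau l hl
  have h4 := htau l' hl'
  rw [hl] at h1
  rw [hl'] at h2
  set T := B.tauDet hN hW (List.replicate N e) (List.length_replicate ..)
  linear_combination ((l'.map a).prod * (l'.map hs.coord).prod) * h3
    + (l.map b).prod * T * h2 - ((l.map a).prod * (l.map hs.coord).prod) * h4
    - (l'.map b).prod * T * h1

/-- There is a global function `f` such that `τ` maps every product of `N` determinants to the
product of `f` with their coordinates. -/
lemma exists_tauDet_eq {W₀ : X.Opens} (hW₀ : IsAffineOpen W₀) [Nonempty W₀]
    {e : Fin (Module.finrank ℂ V) → Γ(B.A, W₀)} (he : IsSheafBasis e) :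
    ∃ f : Γ(X, ⊤), ∀ (W : X.Opens) (hW : IsAffineOpen W) [Nonempty W]
      (l : List (Fin (Module.finrank ℂ V) → Γ(B.A, W))) (hl : l.length = N),
      B.tauDet hN hW l hl = resO le_top f * (l.map hs.coord).prod := by
  have hu : toK W₀ (hs.coord e) ≠ 0 := ((he.isUnit_coord hs).map (toK W₀)).ne_zero
  set F : X.functionField := toK W₀ (B.tauDet hN hW₀ (List.replicate N e)
    (List.length_replicate ..)) / (toK W₀ (hs.coord e)) ^ N with hF
  -- Compare with e on an affine open subset of W ⊓ W₀, which is nonempty since X is irreducible.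
  have hFeq : ∀ (W : X.Opens) (hW : IsAffineOpen W) [Nonempty W]
      (l : List (Fin (Module.finrank ℂ V) → Γ(B.A, W))) (hl : l.length = N),
      toK W (B.tauDet hN hW l hl) = F * toK W (l.map hs.coord).prod := by
    intro W hW _ l hl
    obtain ⟨⟨x, hx⟩⟩ := nonempty_inf W W₀
    obtain ⟨_, ⟨W', hW', rfl⟩, hxW', hle⟩ :=
      X.isBasis_affineOpens.exists_subset_of_mem_open hx (W ⊓ W₀).isOpen
    have hne : Nonempty W' := ⟨⟨x, hxW'⟩⟩
    have h1 : W' ≤ W := fun y hy => (hle hy).1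
    have h2 : W' ≤ W₀ := fun y hy => (hle hy).2
    have key := congrArg (toK W') (B.tauDet_mul_prod_coord hN hs hW'
      (l.map fun m i => resM B.A h1 (m i))
      ((List.replicate N e).map fun m i => resM B.A h2 (m i)) (by simpa using hl) (by simp))
    rw [tauDet_res B hN hW hW' h1 l hl, tauDet_res B hN hW₀ hW' h2 _ (List.length_replicate ..),
      map_mul, map_mul, toK_resO, toK_resO] at key
    rw [hs.toK_prod_coord_res h1, hs.toK_prod_coord_res h2, List.map_replicate,
      List.prod_replicate, map_pow] at key
    rw [hF, div_mul_eq_mul_div, eq_div_iff (pow_ne_zero _ hu), key]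
  -- F times N coordinates is regular because it is a value of τ. `exists_toK_eq` removes one
  -- coordinate factor at a time; k counts the removed factors, and k = N leaves F itself.
  have hreg : ∀ (k : ℕ) (W : X.Opens) [Nonempty W]
      (l : List (Fin (Module.finrank ℂ V) → Γ(B.A, W))), l.length + k = N →
      ∃ f, toK W f = F * toK W (l.map hs.coord).prod := by
    intro k
    induction k with
    | zero =>
      intro W _ l hl
      refine exists_toK_eq_of_affine W _ fun W' h hW' _ => ?_
      refine ⟨_, (hFeq W' hW' (l.map fun m i => resM B.A h (m i)) (by simpa using hl)).trans ?_⟩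
      rw [hs.toK_prod_coord_res]
    | succ k ih =>
      intro W _ l hl
      refine hs.exists_toK_eq he W _ fun W' h hW' _ m => ?_
      obtain ⟨f, hf⟩ := ih W' (m :: l.map fun m i => resM B.A h (m i)) (by simp; omega)
      refine ⟨f, ?_⟩
      rw [hf, List.map_cons, List.prod_cons, map_mul, hs.toK_prod_coord_res]
      ring
  have : Nonempty (⊤ : X.Opens) := ‹Nonempty W₀›.map fun x => ⟨x.1, trivial⟩
  obtain ⟨f, hf⟩ := hreg N ⊤ [] (by simp)
  refine ⟨f, fun W hW _ l hl => ?_⟩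
  apply toK_injective W
  rw [hFeq, map_mul, toK_resO, hf]
  simp

end SingularPrincipalBundle

end Bundle

end SingularBundle

end

/-! ### The dichotomy: f is zero or a unit. -/

theorem mainTheorem12
    (X : Scheme.{0}) [X.Over (Spec (CommRingCat.of ℂ))] [IsIntegral X]
    [IsProper (X ↘ Spec (CommRingCat.of ℂ))] [Smooth (X ↘ Spec (CommRingCat.of ℂ))]
    (V : Type) [AddCommGroup V] [Module ℂ V] [FiniteDimensional ℂ V]
    (G : Subgroup (V ≃ₗ[ℂ] V)) (hG : SingularBundle.IsReductive G)
    (W : Type) [AddCommGroup W] [Module ℂ W] [FiniteDimensional ℂ W]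
    (κ : Representation ℂ (V ≃ₗ[ℂ] V) W) (w₀ : W)
    (hκ : SingularBundle.IsOrbitEmbedding G κ w₀)
    (B : SingularBundle.SingularPrincipalBundle X (SingularBundle.stabilizerGL κ w₀)) :
    B.IsHonest ∨ B.AvoidsIsom := by
  open SingularBundle in
  by_cases hU : ∃ x, x ∈ B.U
  swap
  -- If U is empty, there is nothing to check.
  · exact Or.inl fun W hW hle x => (hU ⟨x.1, hle x.2⟩).elim
  obtain ⟨x₀, hx₀⟩ := hU
  obtain ⟨W₀, e, hW₀, hx₀W₀, he⟩ := B.torsionFree.exists_isSheafBasis hx₀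
  have : Nonempty W₀ := ⟨⟨x₀, hx₀W₀⟩⟩
  obtain ⟨N, hN, hdet⟩ := hκ.exists_det_pow_eq_one
  obtain ⟨s, hs⟩ := B.trivialDet
  replace hs : IsDetGenerator s := hs
  obtain ⟨f, hf⟩ := B.exists_tauDet_eq hdet hs hW₀ he
  by_cases hf0 : f = 0
  · refine Or.inr fun W hW hle x => ?_
    rintro ⟨q, hq, hqx⟩
    have : Nonempty W := ⟨x⟩
    obtain ⟨m, hm⟩ := exists_detForm_notMem_of_mem_isomLocus (Module.finBasis ℂ V) q hq
    -- As f = 0, the invariant det(m)^N vanishes at σ(x), hence at q, against the choice of m.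
    have hpow : (⟨_, prod_detForm_mem_invariants (Module.finBasis ℂ V) hdet (List.replicate N m)
        (List.length_replicate ..)⟩ : invariants Γ(X, W) Γ(B.A, W) (stabilizerGL κ w₀))
        ∈ (B.σ hW x).asIdeal := by
      change B.tauDet hdet hW (List.replicate N m) (List.length_replicate ..)
        ∈ (hW.primeIdealOf x).asIdeal
      rw [hf W hW, hf0, map_zero, zero_mul]
      exact zero_mem _
    rw [← hqx] at hpow
    change ((List.replicate N m).map _).prod ∈ q.asIdeal at hpow
    rw [List.map_replicate, List.prod_replicate] at hpow
    exact hm (q.isPrime.mem_of_pow_mem _ hpow)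
  · refine Or.inl fun W hW hle x => ?_
    have hne : Nonempty W := ⟨x⟩
    -- Properness enters here: the global functions on X form a field.
    have hfield := isField_of_universallyClosed ℂ (X ↘ Spec (CommRingCat.of ℂ))
    have hfu : IsUnit f := by
      obtain ⟨g, hg⟩ := hfield.mul_inv_cancel hf0
      exact IsUnit.of_mul_eq_one g hg
    obtain ⟨m, hm⟩ := B.torsionFree.exists_coord_notMem hs hW x (hle x.2)
    obtain ⟨q, hq⟩ := hκ.comap_surjective hG (B.σ hW x)
    refine ⟨q, ?_, hq⟩
    have := B.torsionFree.torsionFree W hW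
    refine mem_isomLocus_of_detForm_notMem (Module.finBasis ℂ V) q m (fun hmem => ?_) (hs.coord m)
      (fun hmem => ?_) fun y => smul_mem_span_of_alternating
        (B.torsionFree.rank W hW (Set.nonempty_coe_sort.1 hne)) (hs.coordForm W) m y
    -- If det(m) vanished at q, then τ(det(m)^N) = f·coord(m)^N would vanish at x (this uses N > 0),
    -- although f is a unit and coord(m) is nonzero at x.
    · have hpow : (⟨_, prod_detForm_mem_invariants (Module.finBasis ℂ V) hdet
          (List.replicate N m) (List.length_replicate ..)⟩ :
            invariants Γ(X, W) Γ(B.A, W) (stabilizerGL κ w₀)) ∈ (B.σ hW x).asIdeal := by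
        rw [← hq]
        change ((List.replicate N m).map _).prod ∈ q.asIdeal
        rw [List.map_replicate, List.prod_replicate]
        exact Ideal.pow_mem_of_mem _ hmem N hN
      change B.tauDet hdet hW (List.replicate N m) (List.length_replicate ..)
        ∈ (hW.primeIdealOf x).asIdeal at hpow
      rw [hf W hW, List.map_replicate, List.prod_replicate] at hpow
      rcases (hW.primeIdealOf x).isPrime.mem_or_mem hpow with h | h
      · exact (hW.primeIdealOf x).isPrime.ne_top
          (Ideal.eq_top_of_isUnit_mem _ h (hfu.map (resO le_top)))
      · exact hm ((hW.primeIdealOf x).isPrime.mem_of_pow_mem _ h)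
    -- Since τ is a homomorphism of algebras over the functions on W, the point q lies over x, so
    -- coord(m) is nonzero at q as well.
    · have hmem' : algebraMap Γ(X, W) (invariants Γ(X, W) Γ(B.A, W) (stabilizerGL κ w₀))
          (hs.coord m) ∈ (B.σ hW x).asIdeal := by
        rw [← hq]
        exact hmem
      change B.τ W hW (algebraMap _ _ (hs.coord m)) ∈ (hW.primeIdealOf x).asIdeal at hmem'
      rw [AlgHom.commutes] at hmem'
      exact hm hmem'
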